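/- Let $n\ge 2$, $\epsilon\in\{-1,1\}$, and let $\mathbb{Q}^n_\epsilon$ be the simply connected space form of dimension $n$ and constant curvature $\epsilon$ (so $\mathbb{Q}^n_{-1}=\mathbb{H}^n$, $\mathbb{Q}^n_{1}=\mathbb{S}^n$). Put $C_{-1}:=n-1$ and $C_{1}:=0$. The mean curvature of a hypersurface of $\mathbb{Q}^n_\epsilon\times\mathbb{R}$ is the (non-normalized) trace of its shape operator. Fix a point $(o,h)\in\mathbb{Q}^n_\epsilon\times\mathbb{R}$ and let $\mathscr F_\epsilon$ be the family of all smooth embedded spheres $\Sigma_H$ in $\mathbb{Q}^n_\epsilon\times\mathbb{R}$ of constant mean curvature $H>C_\epsilon$ (with respect to a suitable unit normal) which are rotational with axis $\{o\}\times\mathbb{R}$, i.e. invariant under all isometries of $\mathbb{Q}^n_\epsilon$ fixing $o$ (acting trivially on $\mathbb{R}$), and which have $(o,h)$ as a point of minimal height. Let $\Omega_H$ be the compact region determined by $\Sigma_H$, i.e. the union of $\Sigma_H$ and the bounded connected components of its complement. Then there is a constant $\alpha\ge C_\epsilon$ (so $\alpha\ge 0$), depending only on $n$ and $\epsilon$,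 such that, whenever $\Sigma_H,\Sigma_{H^*}\in\mathscr F_\epsilon$ satisfy $H>H^*>\alpha$, one has $\Omega_H\subset\Omega_{H^*}$. Moreover, for $\epsilon=-1$ one can take $\alpha=C_{-1}=n-1$, so that the whole family $\mathscr F_{-1}$ is nested. -/

import Mathlib

open scoped ContDiff

namespace QProd

/-- The vector space `ℝ^{n+1} = ℝ × ℝ^n` in which the space form of dimension `n` sits. -/
abbrev Vec (n : ℕ) : Type := ℝ × EuclideanSpace ℝ (Fin n)

/-- The vector space `ℝ^{n+1} × ℝ` in which the product of the space form with `ℝ` sits. -/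
abbrev Amb (n : ℕ) : Type := Vec n × ℝ

/-- The form `ε x₀ y₀ + x₁ y₁ + ⋯ + xₙ yₙ`: Euclidean for `ε = 1`, Lorentzian for `ε = -1`. -/
noncomputable def form {n : ℕ} (ε : ℝ) (x y : Vec n) : ℝ :=
  ε * (x.1 * y.1) + inner ℝ x.2 y.2

/-- The simply connected space form of dimension `n` and curvature `ε ∈ {-1, 1}`: the unit sphere
for `ε = 1`, the upper sheet of the hyperboloid for `ε = -1`. Its Riemannian metric is the
restriction of `form ε` to the tangent spaces. -/
def spaceForm (n : ℕ) (ε : ℝ) : Set (Vec n) :=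
  {x | form ε x x = ε ∧ (ε = -1 → 0 < x.1)}

/-- The product of the space form with `ℝ`. -/
def space (n : ℕ) (ε : ℝ) : Set (Amb n) :=
  spaceForm n ε ×ˢ Set.univ

/-- The product form on `ℝ^{n+1} × ℝ`; restricted to the tangent spaces of `space n ε` it is the
product Riemannian metric. -/
noncomputable def metric {n : ℕ} (ε : ℝ) (v w : Amb n) : ℝ :=
  form ε v.1 w.1 + v.2 * w.2

/-- The tangent space of `space n ε` at `p`. -/
def tangentTo {n : ℕ} (ε : ℝ) (p : Amb n) : Set (Amb n) :=
  {v | form ε p.1 v.1 = 0}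

/-- `S` is a smooth embedded hypersurface of `space n ε`, and `N` (restricted to `S`) is a smooth
unit normal field along it. Locally `S` is a regular level set in `space n ε`, and `N` spans the
direction of the gradient of the defining function. -/
structure IsHypersurface {n : ℕ} (ε : ℝ) (S : Set (Amb n)) (N : Amb n → Amb n) : Prop where
  subset : S ⊆ space n ε
  smooth_normal : ∀ p ∈ S, ContDiffAt ℝ ∞ N p
  normal_tangent : ∀ p ∈ S, N p ∈ tangentTo ε p
  normal_unit : ∀ p ∈ S, metric ε (N p) (N p) = 1
  level_set : ∀ p ∈ S, ∃ (U : Set (Amb n)) (F : Amb n → ℝ),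
    IsOpen U ∧ p ∈ U ∧ ContDiffOn ℝ ∞ F U ∧
    (∀ q ∈ U, q ∈ space n ε → (q ∈ S ↔ F q = 0)) ∧
    ∃ c : ℝ, c ≠ 0 ∧ ∀ v ∈ tangentTo ε p, fderiv ℝ F p v = c * metric ε (N p) v

/-- `e` is an orthonormal basis of the tangent space at `p` of a hypersurface with unit
normal `N p` at `p`. -/
structure IsTangentFrame {n : ℕ} (ε : ℝ) (N : Amb n → Amb n) (p : Amb n)
    (e : Fin n → Amb n) : Prop where
  tangent : ∀ i, e i ∈ tangentTo ε p
  orthogonal_normal : ∀ i, metric ε (N p) (e i) = 0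
  orthonormal : ∀ i j, metric ε (e i) (e j) = if i = j then 1 else 0

/-- The (non-normalized) mean curvature of `S` with respect to `N` is constant, equal to `H`: at
every point the trace of the shape operator, the tangential part of `-dN`, is `H`. -/
def HasConstMeanCurvature {n : ℕ} (ε : ℝ) (S : Set (Amb n)) (N : Amb n → Amb n) (H : ℝ) : Prop :=
  ∀ p ∈ S, ∀ e : Fin n → Amb n, IsTangentFrame ε N p e →
    ∑ i, metric ε (-(fderiv ℝ N p (e i))) (e i) = H

/-- `S` is rotational with axis `{o} × ℝ`: it is invariant under every isometry of the space form
that fixes `o`, acting trivially on the factor `ℝ`. These isometries are the restrictions of the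
linear automorphisms that preserve `form ε` and fix `o`. -/
def IsRotational {n : ℕ} (ε : ℝ) (o : Vec n) (S : Set (Amb n)) : Prop :=
  ∀ L : Vec n ≃ₗ[ℝ] Vec n, (∀ x y, form ε (L x) (L y) = form ε x y) → L o = o →
    ∀ p ∈ S, (L p.1, p.2) ∈ S

/-- `S` is an embedded rotational sphere with axis `{o} × ℝ`, of constant mean curvature `H`, whose
point of minimal height is `(o, h)`. -/
structure IsRotationalCMCSphere {n : ℕ} (ε : ℝ) (o : Vec n) (h H : ℝ) (S : Set (Amb n)) :
    Prop where
  sphere : Nonempty (S ≃ₜ Metric.sphere (0 : EuclideanSpace ℝ (Fin (n + 1))) 1)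
  rotational : IsRotational ε o S
  cmc : ∃ N : Amb n → Amb n, IsHypersurface ε S N ∧ HasConstMeanCurvature ε S N H
  lowest_mem : (o, h) ∈ S
  lowest : ∀ p ∈ S, h ≤ p.2

/-- The closed region determined by `S` in `space n ε`: `S` together with the bounded connected
components of its complement. -/
def region {n : ℕ} (ε : ℝ) (S : Set (Amb n)) : Set (Amb n) :=
  S ∪ {p | p ∈ space n ε \ S ∧ Bornology.IsBounded (connectedComponentIn (space n ε \ S) p)}

open Classical in
/-- The constant `C_ε`: it is `n - 1` for `ε = -1` and `0` for `ε = 1`. -/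
noncomputable def critCurv (n : ℕ) (ε : ℝ) : ℝ :=
  if ε = -1 then (n : ℝ) - 1 else 0

end QProd

/-! Write n = m + 1, let sn be the sine of curvature ε, and let `ratio` g(r) = (∫₀^r sn^m) / sn(r)^m
be the volume of a geodesic ball over the area of its boundary. On the profile curve of a rotational
sphere of mean curvature H, with tangent angle θ, flux conservation reads sin θ = H g(r). Hence cos
θ dθ = H g'(r) dr, and dt = tan θ dr becomes dt = (g/g') dθ: the height is an integral over θ of
g/g' evaluated where g = sin θ / H.

If g is log-concave, g/g' is monotone, so the total height decreases when H grows
(`AdmissibleCurv.height_pi_le`). In the variable v = g(r), the lower half has slope speed(v) · H /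
√(1 - H²v²), which increases with H, so with a common lowest point the lower graph of larger H lies
above (`AdmissibleCurv.height_arcsin_le`). The upper half is the mirror image of the lower one, so
it lies below. This is the nesting (`AdmissibleCurv.solid_subset`).

Log-concavity of g reduces to a bound on g/sn (`Admissible.powInt_le`), valid at every radius for ε
= -1 and up to π/4 for ε = 1. For ε = -1, every H > m has its sphere in some ball, since g
eventually exceeds 1/H; for ε = 1, α is chosen to keep the spheres within radius π/4.

The hypotheses on S give only a set with a normal field. The meridian section satisfies the profile
equations (`IsHypersurface.isProfile`), a clopen argument identifies it with the explicit curve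
(`IsProfile.eq_profileCurve`), and the bounded components of the complement are then found through
the half-plane of pairs (radius, height). -/

namespace QProd

/-! ### Log-concavity of the volume-to-area ratio. -/

/-- The cosine of curvature `ε`. -/
noncomputable def cs (ε r : ℝ) : ℝ := if ε = 1 then Real.cos r else Real.cosh r

/-- The sine of curvature `ε`. -/
noncomputable def sn (ε r : ℝ) : ℝ := if ε = 1 then Real.sin r else Real.sinh r

@[simp] lemma cs_zero (ε : ℝ) : cs ε 0 = 1 := by unfold cs; split_ifs <;> simp

@[simp] lemma sn_zero (ε : ℝ) : sn ε 0 = 0 := by unfold sn; split_ifs <;> simp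

lemma hasDerivAt_sn (ε r : ℝ) : HasDerivAt (sn ε) (cs ε r) r := by
  unfold sn cs
  split_ifs
  · exact Real.hasDerivAt_sin r
  · exact Real.hasDerivAt_sinh r

lemma hasDerivAt_cs {ε : ℝ} (hε : ε = -1 ∨ ε = 1) (r : ℝ) :
    HasDerivAt (cs ε) (-ε * sn ε r) r := by
  unfold sn cs
  rcases hε with rfl | rfl
  · norm_num; exact Real.hasDerivAt_cosh r
  · norm_num; exact Real.hasDerivAt_cos r

lemma cs_sq_add {ε : ℝ} (hε : ε = -1 ∨ ε = 1) (r : ℝ) : cs ε r ^ 2 + ε * sn ε r ^ 2 = 1 := by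
  unfold sn cs
  rcases hε with rfl | rfl
  · norm_num; linarith [Real.cosh_sq r]
  · norm_num

lemma contDiff_sn {k : WithTop ℕ∞} (ε : ℝ) : ContDiff ℝ k (sn ε) := by
  unfold sn
  split_ifs
  · exact Real.contDiff_sin
  · exact Real.contDiff_sinh

lemma contDiff_cs {k : WithTop ℕ∞} (ε : ℝ) : ContDiff ℝ k (cs ε) := by
  unfold cs
  split_ifs
  · exact Real.contDiff_cos
  · exact Real.contDiff_cosh

lemma continuous_sn (ε : ℝ) : Continuous (sn ε) := (contDiff_sn (k := 0) ε).continuous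

lemma continuous_cs (ε : ℝ) : Continuous (cs ε) := (contDiff_cs (k := 0) ε).continuous

/-- The integral of the `m`-th power of `sn` from `0` to `r`. -/
noncomputable def powInt (m : ℕ) (ε r : ℝ) : ℝ := ∫ x in (0 : ℝ)..r, sn ε x ^ m

@[simp] lemma powInt_zero (m : ℕ) (ε : ℝ) : powInt m ε 0 = 0 := by simp [powInt]

lemma hasDerivAt_powInt (m : ℕ) (ε r : ℝ) : HasDerivAt (powInt m ε) (sn ε r ^ m) r := by
  have h : Continuous fun x => sn ε x ^ m := (continuous_sn ε).pow m
  exact intervalIntegral.integral_hasDerivAt_right (h.intervalIntegrable _ _)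
    (h.stronglyMeasurableAtFilter _ _) h.continuousAt

lemma continuous_powInt (m : ℕ) (ε : ℝ) : Continuous (powInt m ε) :=
  continuous_iff_continuousAt.2 fun r => (hasDerivAt_powInt m ε r).continuousAt

/-- Volume of a ball of radius `r` divided by the area of its boundary. -/
noncomputable def ratio (m : ℕ) (ε r : ℝ) : ℝ := powInt m ε r / sn ε r ^ m

/-- The derivative of `ratio`. -/
noncomputable def ratioDeriv (m : ℕ) (ε r : ℝ) : ℝ :=
  1 - m * (cs ε r / sn ε r) * ratio m ε r

@[simp] lemma ratio_zero (m : ℕ) (ε : ℝ) : ratio m ε 0 = 0 := by simp [ratio]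

lemma hasDerivAt_ratio (m : ℕ) (ε : ℝ) {r : ℝ} (h : sn ε r ≠ 0) :
    HasDerivAt (ratio m ε) (ratioDeriv m ε r) r := by
  have h1 := (hasDerivAt_powInt m ε r).div ((hasDerivAt_sn ε r).pow m) (pow_ne_zero m h)
  convert! h1 using 1
  unfold ratioDeriv ratio
  rcases m with _ | m
  · simp
  · simp only [Nat.add_sub_cancel, Pi.pow_apply]
    field_simp
    ring

/-- On `[0, R]` the geometry is such that `ratio` is log-concave. -/
structure Admissible (m : ℕ) (ε R : ℝ) : Prop where
  eps : ε = -1 ∨ ε = 1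
  one_le : 1 ≤ m
  pos : 0 < R
  sn_pos : ∀ r ∈ Set.Ioc 0 R, 0 < sn ε r
  cs_pos : ∀ r ∈ Set.Icc 0 R, 0 < cs ε r
  cs_sq_ge : ∀ r ∈ Set.Icc 0 R, (m : ℝ) ≤ 2 * (m + 2) * cs ε r ^ 2

variable {m : ℕ} {ε R r : ℝ}

lemma Admissible.sn_ne (h : Admissible m ε R) (hr : r ∈ Set.Ioc 0 R) : sn ε r ≠ 0 :=
  (h.sn_pos r hr).ne'

lemma Admissible.powInt_pos (h : Admissible m ε R) (hr : r ∈ Set.Ioc 0 R) :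
    0 < powInt m ε r := by
  refine intervalIntegral.intervalIntegral_pos_of_pos_on
    (((continuous_sn ε).pow m).intervalIntegrable _ _) (fun x hx => ?_) hr.1
  exact pow_pos (h.sn_pos x ⟨hx.1, hx.2.le.trans hr.2⟩) m

/-- The bound says that y = ratio / sn is at most the positive root 2 / (mc + √(m²c² + 4m)) of m y²
+ m c y = 1, where c = cs; this is the quadratic condition behind log-concavity. Both sides vanish
at 0, so it suffices to compare derivatives. -/
lemma Admissible.powInt_le (h : Admissible m ε R) (hr : r ∈ Set.Icc 0 R) :
    powInt m ε r ≤
      2 * sn ε r ^ (m + 1) / (m * cs ε r + √(m ^ 2 * cs ε r ^ 2 + 4 * m)) := by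
  have hm : (1 : ℝ) ≤ m := by exact_mod_cast h.one_le
  set w : ℝ → ℝ := fun r => √(m ^ 2 * cs ε r ^ 2 + 4 * m) with hw
  have hin : ∀ x, 0 < (m : ℝ) ^ 2 * cs ε x ^ 2 + 4 * m := fun x => by positivity
  have hwpos : ∀ x, 0 < w x := fun x => Real.sqrt_pos.2 (hin x)
  have hwsq : ∀ x, w x ^ 2 = m ^ 2 * cs ε x ^ 2 + 4 * m := fun x => Real.sq_sqrt (hin x).le
  have hD : ∀ x ∈ Set.Icc 0 R, 0 < m * cs ε x + w x := fun x hx => by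
    have := h.cs_pos x hx
    have := hwpos x
    positivity
  have hwd : ∀ x, HasDerivAt w (m ^ 2 * cs ε x * (-ε * sn ε x) / w x) x := fun x => by
    have h1 := ((((hasDerivAt_cs h.eps x).pow 2).const_mul ((m : ℝ) ^ 2)).add_const
      (4 * (m : ℝ))).sqrt (by simpa using (hin x).ne')
    convert! h1 using 1
    simp only [Pi.pow_apply, hw]
    field_simp
    ring
  have hBd : ∀ x ∈ Set.Icc 0 R, HasDerivAt (fun x => 2 * sn ε x ^ (m + 1) / (m * cs ε x + w x)
      - powInt m ε x)
      ((2 * ((m + 1) * sn ε x ^ m * cs ε x) * (m * cs ε x + w x) - 2 * sn ε x ^ (m + 1) *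
        (m * (-ε * sn ε x) + m ^ 2 * cs ε x * (-ε * sn ε x) / w x)) / (m * cs ε x + w x) ^ 2
        - sn ε x ^ m) x := fun x hx => by
    have h1 := ((((hasDerivAt_sn ε x).pow (m + 1)).const_mul 2).div
      (((hasDerivAt_cs h.eps x).const_mul (m : ℝ)).add (hwd x)) (hD x hx).ne').sub
      (hasDerivAt_powInt m ε x)
    convert! h1 using 1
    simp
  have hmono : MonotoneOn (fun x => 2 * sn ε x ^ (m + 1) / (m * cs ε x + w x) - powInt m ε x)
      (Set.Icc 0 R) := by
    refine monotoneOn_of_deriv_nonneg (convex_Icc 0 R)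
      (fun x hx => (hBd x hx).continuousAt.continuousWithinAt) ?_ ?_
    · rw [interior_Icc]
      exact fun x hx => (hBd x ⟨hx.1.le, hx.2.le⟩).differentiableAt.differentiableWithinAt
    · rw [interior_Icc]
      intro x hx
      have hx' : x ∈ Set.Icc 0 R := ⟨hx.1.le, hx.2.le⟩
      rw [(hBd x hx').deriv]
      have hs := h.sn_pos x ⟨hx.1, hx.2.le⟩
      have hc := h.cs_pos x hx'
      have hge := h.cs_sq_ge x hx'
      have hDx := hD x hx'
      have hwx := hwpos x
      have hws := hwsq x
      have hsq := cs_sq_add h.eps x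
      set c := cs ε x
      set s := sn ε x
      set W := w x
      -- The squares of the two sides differ by 4m (2(m + 2)c² - m); the field `cs_sq_ge` is exactly
      -- the nonnegativity of this.
      have key : (m : ℝ) * (m + 2) * c ^ 2 + 2 * m ≤ (m + 2) * c * W := by
        refine le_of_sq_le_sq ?_ (by positivity)
        have e : ((m + 2) * c * W) ^ 2 = (m + 2) ^ 2 * c ^ 2 * (m ^ 2 * c ^ 2 + 4 * m) := by
          rw [← hws]; ring
        rw [e]
        nlinarith [mul_nonneg (by positivity : (0 : ℝ) ≤ 4 * m) (sub_nonneg.2 hge)]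
      have e2 : (2 * ((m + 1) * s ^ m * c) * (m * c + W) - 2 * s ^ (m + 1) *
        (m * (-ε * s) + m ^ 2 * c * (-ε * s) / W)) / (m * c + W) ^ 2
        - s ^ m = s ^ m / ((m * c + W) * W) * ((m + 2) * c * W - (m * (m + 2) * c ^ 2 + 2 * m)) := by
        have : ε * s ^ 2 = 1 - c ^ 2 := by linarith
        have e3 : 2 * s ^ (m + 1) * (m * (-ε * s) + m ^ 2 * c * (-ε * s) / W) =
          - 2 * s ^ m * m * (1 - c ^ 2) * (m * c + W) / W := by
          rw [← this]; field_simp; ring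
        rw [e3]
        field_simp
        linear_combination -hws
      rw [e2]
      exact mul_nonneg (by positivity) (sub_nonneg.2 key)
  have := hmono ⟨le_rfl, h.pos.le⟩ hr hr.1
  simp at this
  linarith

lemma Admissible.ratio_nonneg (h : Admissible m ε R) (hr : r ∈ Set.Icc 0 R) :
    0 ≤ ratio m ε r := by
  rcases hr.1.eq_or_lt with rfl | h0
  · simp
  · exact (div_pos (h.powInt_pos ⟨h0, hr.2⟩) (pow_pos (h.sn_pos r ⟨h0, hr.2⟩) m)).le

lemma Admissible.ratio_pos (h : Admissible m ε R) (hr : r ∈ Set.Ioc 0 R) :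
    0 < ratio m ε r :=
  div_pos (h.powInt_pos hr) (pow_pos (h.sn_pos r hr) m)

lemma Admissible.ratio_le_sn (h : Admissible m ε R) (hr : r ∈ Set.Ioc 0 R) :
    ratio m ε r * (m * cs ε r + √(m ^ 2 * cs ε r ^ 2 + 4 * m)) ≤ 2 * sn ε r := by
  have hs := h.sn_pos r hr
  have hr' : r ∈ Set.Icc 0 R := ⟨hr.1.le, hr.2⟩
  have hc := h.cs_pos r hr'
  have hm : (1 : ℝ) ≤ m := by exact_mod_cast h.one_le
  have h1 := h.powInt_le hr'
  rw [le_div_iff₀ (by positivity)] at h1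
  unfold ratio
  rw [div_mul_eq_mul_div, div_le_iff₀ (by positivity)]
  calc _ ≤ _ := h1
    _ = _ := by ring

/-- The inequality behind the log-concavity of `ratio`. -/
lemma Admissible.sq_ratio_le (h : Admissible m ε R) (hr : r ∈ Set.Ioc 0 R) :
    m * (ratio m ε r / sn ε r) ^ 2 ≤ ratioDeriv m ε r := by
  have hs := h.sn_pos r hr
  have hr' : r ∈ Set.Icc 0 R := ⟨hr.1.le, hr.2⟩
  have hc := h.cs_pos r hr'
  have hm : (1 : ℝ) ≤ m := by exact_mod_cast h.one_le
  have h1 := h.ratio_le_sn hr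
  have hg := h.ratio_pos hr
  have hy : 0 < ratio m ε r / sn ε r := by positivity
  have h2 : ratio m ε r / sn ε r * (m * cs ε r + √(m ^ 2 * cs ε r ^ 2 + 4 * m)) ≤ 2 := by
    rw [div_mul_eq_mul_div, div_le_iff₀ hs]; exact h1
  have e : ratioDeriv m ε r = 1 - m * cs ε r * (ratio m ε r / sn ε r) := by
    unfold ratioDeriv; ring
  rw [e]
  set y := ratio m ε r / sn ε r
  have hw : √(m ^ 2 * cs ε r ^ 2 + 4 * m) ^ 2 = m ^ 2 * cs ε r ^ 2 + 4 * m :=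
    Real.sq_sqrt (by positivity)
  set w := √(m ^ 2 * cs ε r ^ 2 + 4 * m)
  have hw0 : 0 ≤ w := Real.sqrt_nonneg _
  set c := cs ε r
  have hcw : m * c ≤ w := by
    refine le_of_sq_le_sq ?_ hw0
    nlinarith
  have h3 : y * w ≤ 2 - y * (m * c) := by linarith
  have h4 : (y * w) ^ 2 ≤ (2 - y * (m * c)) ^ 2 := by
    gcongr
  have h5 : (y * w) ^ 2 = y ^ 2 * (m ^ 2 * c ^ 2 + 4 * m) := by rw [← hw]; ring
  nlinarith

lemma Admissible.ratioDeriv_pos (h : Admissible m ε R) (hr : r ∈ Set.Ioc 0 R) :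
    0 < ratioDeriv m ε r := by
  have hs := h.sn_pos r hr
  have hm : (1 : ℝ) ≤ m := by exact_mod_cast h.one_le
  have hg := h.ratio_pos hr
  exact lt_of_lt_of_le (by positivity) (h.sq_ratio_le hr)

lemma Admissible.ratio_le_sn' (h : Admissible m ε R) (hr : r ∈ Set.Icc 0 R) :
    ratio m ε r ≤ sn ε r := by
  rcases hr.1.eq_or_lt with rfl | h0
  · simp
  have hr' : r ∈ Set.Ioc 0 R := ⟨h0, hr.2⟩
  have hm : (1 : ℝ) ≤ m := by exact_mod_cast h.one_le
  have h1 := h.ratio_le_sn hr'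
  have hg := h.ratio_pos hr'
  have hc := h.cs_pos r hr
  have hw : 2 ≤ √(m ^ 2 * cs ε r ^ 2 + 4 * m) := by
    apply Real.le_sqrt_of_sq_le
    nlinarith [sq_nonneg ((m : ℝ) * cs ε r)]
  nlinarith [mul_pos hg hc, mul_nonneg hg.le (sub_nonneg.2 hw),
    mul_pos (mul_pos hg hc) (by linarith : (0 : ℝ) < m)]

lemma Admissible.continuousOn_ratio (h : Admissible m ε R) :
    ContinuousOn (ratio m ε) (Set.Icc 0 R) := by
  intro r hr
  rcases hr.1.eq_or_lt with rfl | h0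
  -- At 0 the quotient is 0/0, whose default value 0 is also the limit, by squeezing between 0 and
  -- sn.
  · have hsn : Filter.Tendsto (sn ε) (nhdsWithin 0 (Set.Icc 0 R)) (nhds 0) := by
      have := (continuous_sn ε).continuousWithinAt (s := Set.Icc 0 R) (x := 0)
      simpa [ContinuousWithinAt] using this
    have : Filter.Tendsto (ratio m ε) (nhdsWithin 0 (Set.Icc 0 R)) (nhds 0) :=
      tendsto_of_tendsto_of_tendsto_of_le_of_le' tendsto_const_nhds hsn
        (Filter.eventually_of_mem self_mem_nhdsWithin fun x hx => h.ratio_nonneg hx)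
        (Filter.eventually_of_mem self_mem_nhdsWithin fun x hx => h.ratio_le_sn' hx)
    simpa [ContinuousWithinAt] using this
  · exact (hasDerivAt_ratio m ε (h.sn_ne ⟨h0, hr.2⟩)).continuousAt.continuousWithinAt

lemma Admissible.strictMonoOn_ratio (h : Admissible m ε R) :
    StrictMonoOn (ratio m ε) (Set.Icc 0 R) := by
  refine strictMonoOn_of_deriv_pos (convex_Icc 0 R) h.continuousOn_ratio ?_
  rw [interior_Icc]
  intro x hx
  have hx' : x ∈ Set.Ioc 0 R := ⟨hx.1, hx.2.le⟩
  rw [(hasDerivAt_ratio m ε (h.sn_ne hx')).deriv]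
  exact h.ratioDeriv_pos hx'

lemma Admissible.hasDerivAt_ratioDeriv (h : Admissible m ε R) (hr : r ∈ Set.Ioc 0 R) :
    HasDerivAt (ratioDeriv m ε)
      (m * ratio m ε r / sn ε r ^ 2 - m * (cs ε r / sn ε r) * ratioDeriv m ε r) r := by
  have hs := h.sn_ne hr
  have h1 := ((((hasDerivAt_cs h.eps r).div (hasDerivAt_sn ε r) hs).const_mul (m : ℝ)).mul
    (hasDerivAt_ratio m ε hs)).const_sub 1
  convert! h1 using 1
  have := cs_sq_add h.eps r
  have e : (-ε * sn ε r * sn ε r - cs ε r * cs ε r) = -1 := by linarith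
  simp only [e, Pi.div_apply]
  ring

/-- The function `ratio / ratioDeriv` is monotone where `ratio` is log-concave. -/
lemma Admissible.monotoneOn_div (h : Admissible m ε R) :
    MonotoneOn (fun r => ratio m ε r / ratioDeriv m ε r) (Set.Icc 0 R) := by
  have hd : ∀ x ∈ Set.Ioc 0 R, HasDerivAt (fun r => ratio m ε r / ratioDeriv m ε r)
      ((ratioDeriv m ε x * ratioDeriv m ε x - ratio m ε x * (m * ratio m ε x / sn ε x ^ 2
        - m * (cs ε x / sn ε x) * ratioDeriv m ε x)) / ratioDeriv m ε x ^ 2) x := fun x hx =>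
    (hasDerivAt_ratio m ε (h.sn_ne hx)).div (h.hasDerivAt_ratioDeriv hx) (h.ratioDeriv_pos hx).ne'
  have h1 : MonotoneOn (fun r => ratio m ε r / ratioDeriv m ε r) (Set.Ioc 0 R) := by
    refine monotoneOn_of_deriv_nonneg (convex_Ioc 0 R)
      (fun x hx => (hd x hx).continuousAt.continuousWithinAt) ?_ ?_
    · exact fun x hx => (hd x (interior_subset hx)).differentiableAt.differentiableWithinAt
    · intro x hx
      replace hx := interior_subset hx
      rw [(hd x hx).deriv]
      apply div_nonneg _ (sq_nonneg _)
      have hs := h.sn_pos x hx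
      have h2 := h.sq_ratio_le hx
      -- The numerator of the quotient rule collapses to `ratioDeriv` - m (ratio / sn)², the
      -- quantity controlled by `sq_ratio_le`.
      have e : ratioDeriv m ε x * ratioDeriv m ε x - ratio m ε x * (m * ratio m ε x / sn ε x ^ 2
        - m * (cs ε x / sn ε x) * ratioDeriv m ε x) =
        ratioDeriv m ε x * (ratioDeriv m ε x + m * (cs ε x / sn ε x) * ratio m ε x)
          - m * (ratio m ε x / sn ε x) ^ 2 := by
        field_simp
        ring
      have e2 : ratioDeriv m ε x + m * (cs ε x / sn ε x) * ratio m ε x = 1 := by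
        unfold ratioDeriv; ring
      rw [e, e2]
      linarith
  -- At 0, division by zero gives `ratioDeriv` the value 1 instead of the limit 1/(m + 1); this is
  -- harmless because the numerator `ratio` vanishes there.
  intro x hx y hy hxy
  rcases hx.1.eq_or_lt with rfl | h0
  · simp only [ratio_zero, zero_div]
    rcases hy.1.eq_or_lt with rfl | h0
    · simp
    · exact div_nonneg (h.ratio_nonneg hy) (h.ratioDeriv_pos ⟨h0, hy.2⟩).le
  · exact h1 ⟨h0, hx.2⟩ ⟨h0.trans_le hxy, hy.2⟩ hxy

lemma admissible_neg_one (hm : 1 ≤ m) (hR : 0 < R) : Admissible m (-1) R where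
  eps := Or.inl rfl
  one_le := hm
  pos := hR
  sn_pos r hr := by
    unfold sn; norm_num; exact hr.1
  cs_pos r hr := by
    unfold cs; norm_num; exact Real.cosh_pos r
  cs_sq_ge r hr := by
    have : 1 ≤ cs (-1) r := by unfold cs; norm_num
    have h2 : 1 ≤ cs (-1) r ^ 2 := one_le_pow₀ this
    nlinarith [(by positivity : (0 : ℝ) ≤ m)]

/-- The requirement cos² ≥ m / (2(m + 2)) tends to cos² ≥ 1/2 as m grows, so π/4 serves all m at
once. -/
lemma admissible_one (hm : 1 ≤ m) : Admissible m 1 (Real.pi / 4) where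
  eps := Or.inr rfl
  one_le := hm
  pos := by positivity
  sn_pos r hr := by
    unfold sn; norm_num
    exact Real.sin_pos_of_pos_of_lt_pi hr.1 (by linarith [hr.2, Real.pi_pos])
  cs_pos r hr := by
    unfold cs; norm_num
    exact Real.cos_pos_of_mem_Ioo ⟨by linarith [hr.1, Real.pi_pos], by linarith [hr.2, Real.pi_pos]⟩
  cs_sq_ge r hr := by
    unfold cs; norm_num
    have h1 : Real.cos (Real.pi / 4) ≤ Real.cos r :=
      Real.cos_le_cos_of_nonneg_of_le_pi hr.1 (by linarith [Real.pi_pos]) hr.2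
    rw [Real.cos_pi_div_four] at h1
    have h2 : (√2 / 2) ^ 2 ≤ Real.cos r ^ 2 := by gcongr
    rw [div_pow, Real.sq_sqrt (by norm_num)] at h2
    nlinarith [(by positivity : (0 : ℝ) ≤ m)]

/-- If g stayed below 1/H, then g' = 1 - m coth(r) g would eventually be at least 1 - (H + m)/(2H) >
0, because m coth r tends to m < (H + m)/2; so g would be unbounded. -/
lemma exists_lt_ratio_neg_one (hm : 1 ≤ m) {H : ℝ} (hH : (m : ℝ) < H) :
    ∃ R, 0 < R ∧ 1 / H < ratio m (-1) R := by
  have hm' : (1 : ℝ) ≤ m := by exact_mod_cast hm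
  by_contra! hcon
  have hH0 : 0 < H := by linarith
  have hcoth : ∃ r1, 0 < r1 ∧ ∀ r, r1 ≤ r → m * (cs (-1) r / sn (-1) r) ≤ (H + m) / 2 := by
    refine ⟨max 1 (2 * m / (H - m)), by positivity, fun r hr => ?_⟩
    have hr0 : 0 < r := lt_of_lt_of_le (by positivity) hr
    have hs : 0 < Real.sinh r := Real.sinh_pos_iff.2 hr0
    have hs2 : r ≤ Real.sinh r := Real.self_le_sinh_iff.2 hr0.le
    have hc : Real.cosh r ≤ Real.sinh r + 1 := by
      rw [Real.cosh_eq, Real.sinh_eq]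
      have : Real.exp (-r) ≤ 1 := Real.exp_le_one_iff.2 (by linarith)
      linarith
    have h1 : 2 * m / (H - m) ≤ Real.sinh r := (le_max_right _ _).trans (hr.trans hs2)
    rw [div_le_iff₀ (by linarith)] at h1
    unfold cs sn
    norm_num
    rw [mul_div_assoc', div_le_iff₀ hs]
    nlinarith
  obtain ⟨r1, hr1, hc⟩ := hcoth
  set δ := 1 - (H + m) / 2 / H with hδ
  have hδ0 : 0 < δ := by
    rw [hδ, sub_pos, div_lt_one hH0]; linarith
  -- Growth at rate δ over this length exceeds 1/H.
  set r2 := r1 + 1 / H / δ + 1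
  have hr12 : r1 < r2 := by
    have : 0 < 1 / H / δ := by positivity
    simp only [r2]; linarith
  have hadm := admissible_neg_one hm (hr1.trans hr12)
  have hmvt := (convex_Icc r1 r2).mul_sub_le_image_sub_of_le_deriv (f := ratio m (-1)) (C := δ)
    (hadm.continuousOn_ratio.mono (Set.Icc_subset_Icc hr1.le le_rfl))
    (by
      rw [interior_Icc]
      exact fun x hx => (hasDerivAt_ratio m (-1)
        (hadm.sn_ne ⟨hr1.trans hx.1, hx.2.le⟩)).differentiableAt.differentiableWithinAt)
    (by
      rw [interior_Icc]
      intro x hx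
      have hx' : x ∈ Set.Ioc 0 r2 := ⟨hr1.trans hx.1, hx.2.le⟩
      rw [(hasDerivAt_ratio m (-1) (hadm.sn_ne hx')).deriv]
      have h1 := hc x hx.1.le
      have h2 := hcon x hx'.1
      have h3 := hadm.ratio_pos hx'
      have h4 : m * (cs (-1) x / sn (-1) x) * ratio m (-1) x ≤ (H + m) / 2 * (1 / H) := by
        gcongr
      unfold ratioDeriv
      rw [hδ, div_eq_mul_one_div _ H]
      linarith)
    r1 ⟨le_rfl, hr12.le⟩ r2 ⟨hr12.le, le_rfl⟩ hr12.le
  have h1 := hcon r2 (hr1.trans hr12)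
  have h2 := hadm.ratio_nonneg ⟨hr1.le, hr12.le⟩
  have h3 : δ * (r2 - r1) = 1 / H + δ := by
    simp only [r2]; field_simp; ring
  linarith

end QProd

/-! ### The height of the profile curve as a function of its angle, and its dependence on H. -/

namespace QProd

open Set Filter Topology

/-- The inverse of `ratio` on `[0, R]`. -/
noncomputable def invRatio (m : ℕ) (ε R v : ℝ) : ℝ :=
  Function.invFunOn (ratio m ε) (Icc 0 R) v

/-- The function `ratio / ratioDeriv`, expressed through the value of `ratio`. -/
noncomputable def speed (m : ℕ) (ε R v : ℝ) : ℝ :=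
  ratio m ε (invRatio m ε R v) / ratioDeriv m ε (invRatio m ε R v)

/-- The height, above the lowest point, of the rotational sphere of mean curvature `H` at the
point where the profile curve makes the angle `θ` with the horizontal. -/
noncomputable def height (m : ℕ) (ε R H θ : ℝ) : ℝ :=
  ∫ x in (0 : ℝ)..θ, speed m ε R (Real.sin x / H)

variable {m : ℕ} {ε R r v H : ℝ}

lemma Admissible.zero_mem (h : Admissible m ε R) : (0 : ℝ) ∈ Icc 0 R := ⟨le_rfl, h.pos.le⟩

lemma Admissible.R_mem (h : Admissible m ε R) : R ∈ Icc 0 R := ⟨h.pos.le, le_rfl⟩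

lemma Admissible.exists_ratio_eq (h : Admissible m ε R) (hv : v ∈ Icc 0 (ratio m ε R)) :
    ∃ r ∈ Icc 0 R, ratio m ε r = v := by
  have := intermediate_value_Icc h.pos.le h.continuousOn_ratio
  rw [ratio_zero] at this
  exact this hv

lemma Admissible.invRatio_mem (h : Admissible m ε R) (hv : v ∈ Icc 0 (ratio m ε R)) :
    invRatio m ε R v ∈ Icc 0 R :=
  Function.invFunOn_mem (h.exists_ratio_eq hv)

lemma Admissible.ratio_invRatio (h : Admissible m ε R) (hv : v ∈ Icc 0 (ratio m ε R)) :
    ratio m ε (invRatio m ε R v) = v :=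
  Function.invFunOn_eq (h.exists_ratio_eq hv)

lemma Admissible.ratio_mem (h : Admissible m ε R) (hr : r ∈ Icc 0 R) :
    ratio m ε r ∈ Icc 0 (ratio m ε R) :=
  ⟨h.ratio_nonneg hr, h.strictMonoOn_ratio.monotoneOn hr h.R_mem hr.2⟩

lemma Admissible.invRatio_ratio (h : Admissible m ε R) (hr : r ∈ Icc 0 R) :
    invRatio m ε R (ratio m ε r) = r :=
  h.strictMonoOn_ratio.injOn (h.invRatio_mem (h.ratio_mem hr)) hr
    (h.ratio_invRatio (h.ratio_mem hr))

lemma Admissible.strictMonoOn_invRatio (h : Admissible m ε R) :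
    StrictMonoOn (invRatio m ε R) (Icc 0 (ratio m ε R)) := by
  intro x hx y hy hxy
  rw [← h.strictMonoOn_ratio.lt_iff_lt (h.invRatio_mem hx) (h.invRatio_mem hy),
    h.ratio_invRatio hx, h.ratio_invRatio hy]
  exact hxy

lemma Admissible.invRatio_zero (h : Admissible m ε R) : invRatio m ε R 0 = 0 := by
  have := h.invRatio_ratio h.zero_mem
  rwa [ratio_zero] at this

lemma Admissible.invRatio_mem_Ioo (h : Admissible m ε R) (hv : v ∈ Ioo 0 (ratio m ε R)) :
    invRatio m ε R v ∈ Ioo 0 R := by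
  have hR := h.ratio_mem h.R_mem
  have h0 := h.ratio_mem h.zero_mem
  rw [ratio_zero] at h0
  constructor
  · have := h.strictMonoOn_invRatio h0 ⟨hv.1.le, hv.2.le⟩ hv.1
    rwa [h.invRatio_zero] at this
  · have := h.strictMonoOn_invRatio ⟨hv.1.le, hv.2.le⟩ hR hv.2
    rwa [h.invRatio_ratio h.R_mem] at this

lemma Admissible.continuousAt_invRatio (h : Admissible m ε R) (hv : v ∈ Ioo 0 (ratio m ε R)) :
    ContinuousAt (invRatio m ε R) v := by
  refine continuousAt_of_monotoneOn_of_image_mem_nhds (s := Icc 0 (ratio m ε R))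
    h.strictMonoOn_invRatio.monotoneOn (Icc_mem_nhds hv.1 hv.2) ?_
  have h1 := h.invRatio_mem_Ioo hv
  filter_upwards [Icc_mem_nhds h1.1 h1.2] with r hr
  exact ⟨ratio m ε r, h.ratio_mem hr, h.invRatio_ratio hr⟩

lemma Admissible.speed_ratio (h : Admissible m ε R) (hr : r ∈ Icc 0 R) :
    speed m ε R (ratio m ε r) = ratio m ε r / ratioDeriv m ε r := by
  rw [speed, h.invRatio_ratio hr]

lemma Admissible.monotoneOn_speed (h : Admissible m ε R) :
    MonotoneOn (speed m ε R) (Icc 0 (ratio m ε R)) := fun _ hx _ hy hxy =>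
  h.monotoneOn_div (h.invRatio_mem hx) (h.invRatio_mem hy)
    (h.strictMonoOn_invRatio.monotoneOn hx hy hxy)

lemma Admissible.speed_zero (h : Admissible m ε R) : speed m ε R 0 = 0 := by
  simp [speed, h.invRatio_zero]

lemma Admissible.speed_nonneg (h : Admissible m ε R) (hv : v ∈ Icc 0 (ratio m ε R)) :
    0 ≤ speed m ε R v := by
  rw [← h.speed_zero]
  exact h.monotoneOn_speed ⟨le_rfl, hv.1.trans hv.2⟩ hv hv.1

lemma Admissible.speed_pos (h : Admissible m ε R) (hv : v ∈ Ioo 0 (ratio m ε R)) :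
    0 < speed m ε R v := by
  have h1 := h.invRatio_mem_Ioo hv
  have h2 : invRatio m ε R v ∈ Ioc 0 R := ⟨h1.1, h1.2.le⟩
  exact div_pos (h.ratio_pos h2) (h.ratioDeriv_pos h2)

lemma Admissible.continuousAt_speed (h : Admissible m ε R) (hv : v ∈ Ioo 0 (ratio m ε R)) :
    ContinuousAt (speed m ε R) v := by
  have h1 := h.invRatio_mem_Ioo hv
  have h2 : invRatio m ε R v ∈ Ioc 0 R := ⟨h1.1, h1.2.le⟩
  have h3 : ContinuousAt (fun r => ratio m ε r / ratioDeriv m ε r) (invRatio m ε R v) :=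
    (hasDerivAt_ratio m ε (h.sn_ne h2)).continuousAt.div
      (h.hasDerivAt_ratioDeriv h2).continuousAt (h.ratioDeriv_pos h2).ne'
  exact ContinuousAt.comp (f := invRatio m ε R) h3 (h.continuousAt_invRatio hv)

/-- `H` is large enough for the sphere of mean curvature `H` to lie inside the cylinder of
radius `R`. -/
structure AdmissibleCurv (m : ℕ) (ε R H : ℝ) : Prop extends Admissible m ε R where
  H_pos : 0 < H
  lt_ratio : 1 / H < ratio m ε R

lemma AdmissibleCurv.mono {H' : ℝ} (h : AdmissibleCurv m ε R H) (hH : H ≤ H') :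
    AdmissibleCurv m ε R H' where
  toAdmissible := h.toAdmissible
  H_pos := h.H_pos.trans_le hH
  lt_ratio := (one_div_le_one_div_of_le h.H_pos hH).trans_lt h.lt_ratio

lemma AdmissibleCurv.div_mem {y : ℝ} (h : AdmissibleCurv m ε R H) (h0 : 0 ≤ y) (h1 : y ≤ 1) :
    y / H ∈ Icc 0 (ratio m ε R) :=
  ⟨div_nonneg h0 h.H_pos.le,
    ((div_le_div_iff_of_pos_right h.H_pos).2 h1).trans h.lt_ratio.le⟩

lemma AdmissibleCurv.div_mem_Ioo {y : ℝ} (h : AdmissibleCurv m ε R H) (h0 : 0 < y) (h1 : y ≤ 1) :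
    y / H ∈ Ioo 0 (ratio m ε R) :=
  ⟨div_pos h0 h.H_pos,
    ((div_le_div_iff_of_pos_right h.H_pos).2 h1).trans_lt h.lt_ratio⟩

lemma AdmissibleCurv.sin_mem {x : ℝ} (h : AdmissibleCurv m ε R H) (hx : x ∈ Icc 0 Real.pi) :
    Real.sin x / H ∈ Icc 0 (ratio m ε R) :=
  h.div_mem (Real.sin_nonneg_of_mem_Icc hx) (Real.sin_le_one x)

lemma AdmissibleCurv.sin_mem_Ioo {x : ℝ} (h : AdmissibleCurv m ε R H)
    (hx : x ∈ Ioo 0 Real.pi) : Real.sin x / H ∈ Ioo 0 (ratio m ε R) :=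
  h.div_mem_Ioo (Real.sin_pos_of_mem_Ioo hx) (Real.sin_le_one x)

/-- Continuity of `speed` is known only on the open interval; instead, the integrand is monotone on
[0, π/2] and antitone on [π/2, π]. -/
lemma AdmissibleCurv.intervalIntegrable_pi (h : AdmissibleCurv m ε R H) :
    IntervalIntegrable (fun x => speed m ε R (Real.sin x / H)) MeasureTheory.volume 0 Real.pi := by
  have hpi := Real.pi_pos
  refine IntervalIntegrable.trans (b := Real.pi / 2) (MonotoneOn.intervalIntegrable ?_)
    (AntitoneOn.intervalIntegrable ?_)
  · rw [uIcc_of_le (by linarith)]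
    intro x hx y hy hxy
    refine h.monotoneOn_speed (h.sin_mem ⟨hx.1, by linarith [hx.2]⟩)
      (h.sin_mem ⟨hy.1, by linarith [hy.2]⟩) ((div_le_div_iff_of_pos_right h.H_pos).2 ?_)
    exact Real.sin_le_sin_of_le_of_le_pi_div_two (by linarith [hx.1]) hy.2 hxy
  · rw [uIcc_of_le (by linarith)]
    intro x hx y hy hxy
    refine h.monotoneOn_speed (h.sin_mem ⟨by linarith [hy.1], hy.2⟩)
      (h.sin_mem ⟨by linarith [hx.1], hx.2⟩) ((div_le_div_iff_of_pos_right h.H_pos).2 ?_)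
    rw [← Real.sin_pi_sub x, ← Real.sin_pi_sub y]
    exact Real.sin_le_sin_of_le_of_le_pi_div_two (by linarith [hy.2]) (by linarith [hx.1])
      (by linarith)

lemma AdmissibleCurv.intervalIntegrable {a b : ℝ} (h : AdmissibleCurv m ε R H)
    (ha : a ∈ Icc 0 Real.pi) (hb : b ∈ Icc 0 Real.pi) :
    IntervalIntegrable (fun x => speed m ε R (Real.sin x / H)) MeasureTheory.volume a b := by
  refine h.intervalIntegrable_pi.mono_set ?_
  rw [uIcc_of_le Real.pi_pos.le]
  exact uIcc_subset_Icc ha hb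

lemma AdmissibleCurv.hasDerivAt_height {θ : ℝ} (h : AdmissibleCurv m ε R H)
    (hθ : θ ∈ Ioo 0 Real.pi) :
    HasDerivAt (height m ε R H) (speed m ε R (Real.sin θ / H)) θ := by
  have hc : ∀ x ∈ Ioo 0 Real.pi, ContinuousAt (fun x => speed m ε R (Real.sin x / H)) x :=
    fun x hx => ContinuousAt.comp (f := fun x => Real.sin x / H)
      (h.continuousAt_speed (h.sin_mem_Ioo hx)) (by fun_prop)
  refine intervalIntegral.integral_hasDerivAt_right
    (h.intervalIntegrable ⟨le_rfl, Real.pi_pos.le⟩ ⟨hθ.1.le, hθ.2.le⟩) ?_ (hc θ hθ)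
  exact ContinuousOn.stronglyMeasurableAtFilter isOpen_Ioo
    (fun x hx => (hc x hx).continuousWithinAt) θ hθ

lemma AdmissibleCurv.continuousOn_height (h : AdmissibleCurv m ε R H) :
    ContinuousOn (height m ε R H) (Icc 0 Real.pi) := by
  have := intervalIntegral.continuousOn_primitive_interval (a := 0) (b := Real.pi)
    (f := fun x => speed m ε R (Real.sin x / H)) (μ := MeasureTheory.volume)
    (by
      rw [uIcc_of_le Real.pi_pos.le, integrableOn_Icc_iff_integrableOn_Ioc,
        ← intervalIntegrable_iff_integrableOn_Ioc_of_le Real.pi_pos.le]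
      exact h.intervalIntegrable_pi)
  rwa [uIcc_of_le Real.pi_pos.le] at this

lemma AdmissibleCurv.strictMonoOn_height (h : AdmissibleCurv m ε R H) :
    StrictMonoOn (height m ε R H) (Icc 0 Real.pi) := by
  refine strictMonoOn_of_deriv_pos (convex_Icc _ _) h.continuousOn_height ?_
  rw [interior_Icc]
  intro x hx
  rw [(h.hasDerivAt_height hx).deriv]
  exact h.speed_pos (h.sin_mem_Ioo hx)

@[simp] lemma height_zero : height m ε R H 0 = 0 := by simp [height]

/-- The symmetry sin(π - x) = sin x makes the upper half of the sphere the mirror image of the lower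
half. -/
lemma AdmissibleCurv.height_pi_sub {θ : ℝ} (h : AdmissibleCurv m ε R H)
    (hθ : θ ∈ Icc 0 Real.pi) :
    height m ε R H (Real.pi - θ) = height m ε R H Real.pi - height m ε R H θ := by
  have h1 : height m ε R H θ =
      ∫ x in (Real.pi - θ)..Real.pi, speed m ε R (Real.sin x / H) := by
    have := intervalIntegral.integral_comp_sub_left (a := 0) (b := θ)
      (fun x => speed m ε R (Real.sin x / H)) Real.pi
    simp only [Real.sin_pi_sub, sub_zero] at this
    exact this
  have h2 := intervalIntegral.integral_add_adjacent_intervals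
    (h.intervalIntegrable (a := 0) (b := Real.pi - θ) ⟨le_rfl, Real.pi_pos.le⟩
      ⟨by linarith [hθ.2], by linarith [hθ.1]⟩)
    (h.intervalIntegrable (a := Real.pi - θ) (b := Real.pi)
      ⟨by linarith [hθ.2], by linarith [hθ.1]⟩ ⟨Real.pi_pos.le, le_rfl⟩)
  rw [h1]
  unfold height
  linarith

/-- This is where log-concavity is decisive: `speed` is monotone and sin x / H decreases in H, so
the integrands compare pointwise. -/
lemma AdmissibleCurv.height_pi_le {H' : ℝ} (h : AdmissibleCurv m ε R H) (hH : H ≤ H') :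
    height m ε R H' Real.pi ≤ height m ε R H Real.pi := by
  refine intervalIntegral.integral_mono_on Real.pi_pos.le (h.mono hH).intervalIntegrable_pi
    h.intervalIntegrable_pi fun x hx => ?_
  refine h.monotoneOn_speed ((h.mono hH).sin_mem hx) (h.sin_mem hx) ?_
  exact div_le_div_of_nonneg_left (Real.sin_nonneg_of_mem_Icc hx) h.H_pos hH

lemma arcsin_mem_Icc_zero_pi {y : ℝ} (h0 : 0 ≤ y) : Real.arcsin y ∈ Icc 0 Real.pi :=
  ⟨Real.arcsin_nonneg.2 h0, (Real.arcsin_le_pi_div_two y).trans (by linarith [Real.pi_pos])⟩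

/-- The derivative of the height of the lower half of the sphere, as a function of the value
of `ratio`. -/
lemma AdmissibleCurv.hasDerivAt_height_arcsin (h : AdmissibleCurv m ε R H) (hv : 0 < v)
    (hv1 : H * v < 1) :
    HasDerivAt (fun v => height m ε R H (Real.arcsin (H * v)))
      (speed m ε R v * (H / √(1 - (H * v) ^ 2))) v := by
  have hHv : 0 < H * v := mul_pos h.H_pos hv
  have h1 : HasDerivAt (fun v => Real.arcsin (H * v)) (1 / √(1 - (H * v) ^ 2) * (H * 1)) v :=
    (Real.hasDerivAt_arcsin (by linarith) hv1.ne).comp v ((hasDerivAt_id v).const_mul H)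
  have h2 := h.hasDerivAt_height (θ := Real.arcsin (H * v)) ⟨Real.arcsin_pos.2 hHv,
    (Real.arcsin_le_pi_div_two _).trans_lt (by linarith [Real.pi_pos])⟩
  have h3 := h2.comp v h1
  convert! h3 using 1
  rw [Real.sin_arcsin (by linarith) hv1.le, mul_div_cancel_left₀ _ h.H_pos.ne']
  ring

lemma AdmissibleCurv.continuousOn_height_arcsin (h : AdmissibleCurv m ε R H) :
    ContinuousOn (fun v => height m ε R H (Real.arcsin (H * v))) (Ici 0) :=
  h.continuousOn_height.comp (by fun_prop)
    fun v hv => arcsin_mem_Icc_zero_pi (mul_nonneg h.H_pos.le hv)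

/-- Both heights vanish at v = 0, and the factor H / √(1 - (Hv)²) in the slope increases with H.
Only the sign of `speed` matters here. -/
lemma AdmissibleCurv.height_arcsin_le {H' : ℝ} (h : AdmissibleCurv m ε R H) (hH : H ≤ H')
    (hv : 0 ≤ v) (hv1 : H' * v ≤ 1) :
    height m ε R H (Real.arcsin (H * v)) ≤ height m ε R H' (Real.arcsin (H' * v)) := by
  have h' := h.mono hH
  have hH0 := h.H_pos
  have hH'0 := h'.H_pos
  have hd : ∀ x ∈ Ioo 0 (1 / H'), HasDerivAt (fun v => height m ε R H' (Real.arcsin (H' * v)) -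
      height m ε R H (Real.arcsin (H * v)))
      (speed m ε R x * (H' / √(1 - (H' * x) ^ 2)) - speed m ε R x * (H / √(1 - (H * x) ^ 2))) x := by
    intro x hx
    have h1 : H' * x < 1 := by
      have := hx.2
      rwa [lt_div_iff₀ hH'0, mul_comm] at this
    have h2 : H * x < 1 := lt_of_le_of_lt (mul_le_mul_of_nonneg_right hH hx.1.le) h1
    exact (h'.hasDerivAt_height_arcsin hx.1 h1).sub (h.hasDerivAt_height_arcsin hx.1 h2)
  have hmono : MonotoneOn (fun v => height m ε R H' (Real.arcsin (H' * v)) -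
      height m ε R H (Real.arcsin (H * v))) (Icc 0 (1 / H')) := by
    refine monotoneOn_of_deriv_nonneg (convex_Icc _ _)
      ((h'.continuousOn_height_arcsin.sub h.continuousOn_height_arcsin).mono
        fun x hx => hx.1) ?_ ?_
    · rw [interior_Icc]
      exact fun x hx => (hd x hx).differentiableAt.differentiableWithinAt
    · rw [interior_Icc]
      intro x hx
      rw [(hd x hx).deriv, ← mul_sub]
      have h1 : H' * x < 1 := by
        have := hx.2
        rwa [lt_div_iff₀ hH'0, mul_comm] at this
      have h3 : H * x ≤ H' * x := mul_le_mul_of_nonneg_right hH hx.1.le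
      have h4 : 0 ≤ H * x := mul_nonneg hH0.le hx.1.le
      refine mul_nonneg (h.speed_nonneg ⟨hx.1.le, hx.2.le.trans h'.lt_ratio.le⟩)
        (sub_nonneg.2 ?_)
      have h5 : 0 < 1 - (H' * x) ^ 2 := by nlinarith
      have h6 : √(1 - (H' * x) ^ 2) ≤ √(1 - (H * x) ^ 2) := by
        apply Real.sqrt_le_sqrt
        gcongr
      exact div_le_div₀ hH'0.le hH (Real.sqrt_pos.2 h5) h6
  have h1 : v ≤ 1 / H' := by rwa [le_div_iff₀ hH'0, mul_comm]
  have := hmono ⟨le_rfl, by positivity⟩ ⟨hv, h1⟩ hv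
  simpa using this

end QProd

/-! ### Uniqueness for the profile equations in the half-plane. -/

namespace QProd

open Set Filter Topology

variable {m : ℕ} {ε R H : ℝ}

lemma eq_of_hasDerivAt_zero {f : ℝ → ℝ} (hc : ContinuousOn f (Icc 0 1))
    (hd : ∀ s ∈ Ioo (0 : ℝ) 1, HasDerivAt f 0 s) {s : ℝ} (hs : s ∈ Icc (0 : ℝ) 1) :
    f s = f 0 := by
  rcases hs.1.eq_or_lt with rfl | h0
  · rfl
  obtain ⟨c, hc, he⟩ := exists_hasDerivAt_eq_slope f (fun _ => 0) h0
    (hc.mono (Icc_subset_Icc le_rfl hs.2)) fun x hx => hd x ⟨hx.1, hx.2.trans_le hs.2⟩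
  rw [eq_comm, div_eq_zero_iff] at he
  rcases he with he | he <;> linarith

/-- Along a curve satisfying the equations of a rotational hypersurface of constant mean
curvature `H`, being on the profile curve of the sphere of mean curvature `H` is preserved. -/
lemma AdmissibleCurv.exists_angle (h : AdmissibleCurv m ε R H) {r t α β : ℝ → ℝ} {θ₀ d : ℝ}
    (hθ₀ : θ₀ ∈ Icc 0 Real.pi)
    (hrc : ContinuousOn r (Icc 0 1)) (htc : ContinuousOn t (Icc 0 1))
    (hαc : ContinuousOn α (Icc 0 1)) (hβc : ContinuousOn β (Icc 0 1))
    (hr : ∀ s ∈ Ioc (0 : ℝ) 1, r s ∈ Ioc 0 R)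
    (hunit : ∀ s ∈ Ioc (0 : ℝ) 1, α s ^ 2 + β s ^ 2 = 1)
    (hnear : ∀ s ∈ Icc (0 : ℝ) 1, 0 < β s * Real.cos θ₀ - α s * Real.sin θ₀)
    (hode : ∀ s ∈ Ioo (0 : ℝ) 1, ∃ l : ℝ, HasDerivAt r (l * β s) s ∧
      HasDerivAt t (-(l * α s)) s ∧
      HasDerivAt α (-(l * β s * (H + m * (cs ε (r s) / sn ε (r s)) * α s))) s ∧
      HasDerivAt β (l * α s * (H + m * (cs ε (r s) / sn ε (r s)) * α s)) s)
    (hr0 : H * ratio m ε (r 0) = Real.sin θ₀) (hr0' : r 0 ∈ Icc 0 R)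
    (ht0 : t 0 = height m ε R H θ₀ + d)
    (hα0 : α 0 = -Real.sin θ₀) (hβ0 : β 0 = Real.cos θ₀) :
    ∃ θ ∈ Icc 0 Real.pi, H * ratio m ε (r 1) = Real.sin θ ∧ t 1 = height m ε R H θ + d ∧
      α 1 = -Real.sin θ ∧ β 1 = Real.cos θ := by
  have hH := h.H_pos
  have hm := h.one_le
  have hunit' : ∀ s ∈ Icc (0 : ℝ) 1, α s ^ 2 + β s ^ 2 = 1 := fun s hs => by
    rcases hs.1.eq_or_lt with rfl | h0
    · rw [hα0, hβ0, neg_sq, Real.sin_sq_add_cos_sq]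
    · exact hunit s ⟨h0, hs.2⟩
  -- The first integral
  have hflux : ∀ s ∈ Icc (0 : ℝ) 1, α s * sn ε (r s) ^ m + H * powInt m ε (r s) = 0 := by
    intro s hs
    have hz : α 0 * sn ε (r 0) ^ m + H * powInt m ε (r 0) = 0 := by
      rcases hr0'.1.eq_or_lt with h0 | h0
      · rw [← h0]
        simp [show m ≠ 0 by omega]
      · have hne := h.sn_ne ⟨h0, hr0'.2⟩
        rw [hα0, ← hr0, ratio]
        field_simp
        ring
    rw [← hz]
    refine eq_of_hasDerivAt_zero (f := fun s => α s * sn ε (r s) ^ m + H * powInt m ε (r s))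
      ?_ ?_ hs
    · exact (hαc.mul (((continuous_sn ε).comp_continuousOn hrc).pow m)).add
        (continuousOn_const.mul ((continuous_powInt m ε).comp_continuousOn hrc))
    · intro s hs
      obtain ⟨l, h1, -, h3, -⟩ := hode s hs
      have h4 := (hasDerivAt_sn ε (r s)).comp s h1
      have h5 := (hasDerivAt_powInt m ε (r s)).comp s h1
      have h6 := (h3.mul (h4.pow m)).add (h5.const_mul H)
      have hne := h.sn_ne (hr s ⟨hs.1, hs.2.le⟩)
      convert! h6 using 1
      simp only [Pi.pow_apply, Function.comp]
      obtain ⟨j, rfl⟩ : ∃ j, m = j + 1 := ⟨m - 1, by omega⟩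
      simp only [Nat.add_sub_cancel]
      field_simp
      ring
  have hα : ∀ s ∈ Icc (0 : ℝ) 1, α s = -(H * ratio m ε (r s)) := by
    intro s hs
    rcases hs.1.eq_or_lt with rfl | h0
    · rw [hα0, hr0]
    · have hne := h.sn_ne (hr s ⟨h0, hs.2⟩)
      have := hflux s hs
      rw [ratio]
      field_simp
      linarith
  -- With (α, β) = (-sin ϑ, cos ϑ), this is sin(ϑ - θ₀), and `hnear` says cos(ϑ - θ₀) > 0; so the
  -- arcsine lifts the angle continuously.
  set x : ℝ → ℝ := fun s => -α s * Real.cos θ₀ - β s * Real.sin θ₀ with hx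
  set ϑ : ℝ → ℝ := fun s => θ₀ + Real.arcsin (x s) with hϑ
  have hxy : ∀ s ∈ Icc (0 : ℝ) 1, x s ^ 2 + (β s * Real.cos θ₀ - α s * Real.sin θ₀) ^ 2 = 1 := by
    intro s hs
    rw [← hunit' s hs]
    simp only [hx]
    linear_combination (α s ^ 2 + β s ^ 2) * Real.sin_sq_add_cos_sq θ₀
  have hsqrt : ∀ s ∈ Icc (0 : ℝ) 1,
      √(1 - x s ^ 2) = β s * Real.cos θ₀ - α s * Real.sin θ₀ := by
    intro s hs
    rw [← hxy s hs, add_sub_cancel_left, Real.sqrt_sq (hnear s hs).le]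
  have hx1 : ∀ s ∈ Icc (0 : ℝ) 1, -1 < x s ∧ x s < 1 := by
    intro s hs
    have h1 := hxy s hs
    have h2 := hnear s hs
    rw [← abs_lt]
    exact abs_lt_of_sq_lt_sq (by nlinarith) zero_le_one |>.trans_eq (by simp)
  have hsin : ∀ s ∈ Icc (0 : ℝ) 1, Real.sin (ϑ s) = -α s := by
    intro s hs
    simp only [hϑ]
    rw [Real.sin_add, Real.sin_arcsin (hx1 s hs).1.le (hx1 s hs).2.le, Real.cos_arcsin,
      hsqrt s hs]
    simp only [hx]
    linear_combination (-α s) * Real.sin_sq_add_cos_sq θ₀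
  have hcos : ∀ s ∈ Icc (0 : ℝ) 1, Real.cos (ϑ s) = β s := by
    intro s hs
    simp only [hϑ]
    rw [Real.cos_add, Real.sin_arcsin (hx1 s hs).1.le (hx1 s hs).2.le, Real.cos_arcsin,
      hsqrt s hs]
    simp only [hx]
    linear_combination (β s) * Real.sin_sq_add_cos_sq θ₀
  have hbd : ∀ s ∈ Icc (0 : ℝ) 1, -(Real.pi / 2) < ϑ s ∧ ϑ s < Real.pi + Real.pi / 2 := by
    intro s hs
    have h1 := Real.neg_pi_div_two_lt_arcsin.2 (hx1 s hs).1
    have h2 := Real.arcsin_lt_pi_div_two.2 (hx1 s hs).2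
    exact ⟨by simp only [hϑ]; linarith [hθ₀.1], by simp only [hϑ]; linarith [hθ₀.2]⟩
  -- The first integral makes sin ϑ = H · ratio ≥ 0, and by `hbd` the angle cannot reach another
  -- interval where the sine is nonnegative.
  have hmem : ∀ s ∈ Icc (0 : ℝ) 1, ϑ s ∈ Icc 0 Real.pi := by
    intro s hs
    have hrs : r s ∈ Icc 0 R := by
      rcases hs.1.eq_or_lt with rfl | h0
      · exact hr0'
      · exact Ioc_subset_Icc_self (hr s ⟨h0, hs.2⟩)
    have h0 : 0 ≤ Real.sin (ϑ s) := by
      rw [hsin s hs, hα s hs, neg_neg]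
      exact mul_nonneg hH.le (h.ratio_nonneg hrs)
    obtain ⟨h1, h2⟩ := hbd s hs
    constructor
    · by_contra! hneg
      exact absurd h0 (not_le.2 (Real.sin_neg_of_neg_of_neg_pi_lt hneg
        (by linarith [Real.pi_pos])))
    · by_contra! hlt
      have : Real.sin (ϑ s - Real.pi) ≤ 0 := by rw [Real.sin_sub_pi]; linarith
      exact absurd this (not_le.2 (Real.sin_pos_of_pos_of_lt_pi (by linarith)
        (by linarith [Real.pi_pos])))
  have hmem' : ∀ s ∈ Ioo (0 : ℝ) 1, ϑ s ∈ Ioo 0 Real.pi := by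
    intro s hs
    have hs' : s ∈ Icc (0 : ℝ) 1 := ⟨hs.1.le, hs.2.le⟩
    have h0 : 0 < Real.sin (ϑ s) := by
      rw [hsin s hs', hα s hs', neg_neg]
      exact mul_pos hH (h.ratio_pos (hr s ⟨hs.1, hs.2.le⟩))
    obtain ⟨h1, h2⟩ := hmem s hs'
    refine ⟨lt_of_le_of_ne h1 fun he => ?_, lt_of_le_of_ne h2 fun he => ?_⟩
    · rw [← he, Real.sin_zero] at h0; exact h0.false
    · rw [he, Real.sin_pi] at h0; exact h0.false
  have hxc : ContinuousOn x (Icc 0 1) :=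
    (hαc.neg.mul continuousOn_const).sub (hβc.mul continuousOn_const)
  have hϑc : ContinuousOn ϑ (Icc 0 1) :=
    continuousOn_const.add (Real.continuous_arcsin.comp_continuousOn hxc)
  -- The angle moves at rate l H g', so the height function moves at rate (g/g') · l H g' = l H g =
  -- -l α, which is the rate of t.
  have hconst := eq_of_hasDerivAt_zero (f := fun s => t s - height m ε R H (ϑ s))
    (htc.sub (h.continuousOn_height.comp hϑc hmem)) (by
      intro s hs
      have hs' : s ∈ Icc (0 : ℝ) 1 := ⟨hs.1.le, hs.2.le⟩
      obtain ⟨l, h1, h2, h3, h4⟩ := hode s hs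
      have h5 : HasDerivAt x _ s := (h3.neg.mul_const (Real.cos θ₀)).sub
        (h4.mul_const (Real.sin θ₀))
      have h6 := (Real.hasDerivAt_arcsin (hx1 s hs').1.ne' (hx1 s hs').2.ne).comp s h5
      have h7 : HasDerivAt ϑ _ s := h6.const_add θ₀
      have h8 := h2.sub ((h.hasDerivAt_height (hmem' s hs)).comp s h7)
      convert! h8 using 1
      rw [hsqrt s hs', hsin s hs']
      have hrs := hr s ⟨hs.1, hs.2.le⟩
      have h9 : -α s / H = ratio m ε (r s) := by
        rw [hα s hs']; field_simp
      rw [h9, h.speed_ratio (Ioc_subset_Icc_self hrs)]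
      have hq := (h.ratioDeriv_pos hrs).ne'
      have hκ : H + m * (cs ε (r s) / sn ε (r s)) * α s = H * ratioDeriv m ε (r s) := by
        rw [hα s hs', ratioDeriv]; ring
      rw [hκ]
      have hy := (hnear s hs').ne'
      field_simp
      linear_combination l * hα s hs')
    (show (1 : ℝ) ∈ Icc (0 : ℝ) 1 by simp)
  have hϑ0 : ϑ 0 = θ₀ := by
    simp only [hϑ, hx, hα0, hβ0]
    rw [show - -Real.sin θ₀ * Real.cos θ₀ - Real.cos θ₀ * Real.sin θ₀ = 0 by ring]
    simp
  have h1 : (1 : ℝ) ∈ Icc (0 : ℝ) 1 := by simp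
  refine ⟨ϑ 1, hmem 1 h1, ?_, ?_, ?_, (hcos 1 h1).symm⟩
  · rw [hsin 1 h1, hα 1 h1, neg_neg]
  · simp only [hϑ0, ht0] at hconst
    linarith
  · rw [hsin 1 h1, neg_neg]

/-- `S` is, in the half-plane of a meridian, a curve with normal `(a, b)`, the rotation of which
has constant mean curvature `H`. -/
structure IsProfile (m : ℕ) (ε H : ℝ) (S : Set (ℝ × ℝ)) (a b : ℝ × ℝ → ℝ) : Prop where
  diff_fst : ∀ k ∈ S, DifferentiableAt ℝ a k
  diff_snd : ∀ k ∈ S, DifferentiableAt ℝ b k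
  unit : ∀ k ∈ S, sn ε k.1 ≠ 0 → a k ^ 2 + b k ^ 2 = 1
  curv : ∀ k ∈ S, sn ε k.1 ≠ 0 → a k * fderiv ℝ b k (b k, -a k) - b k * fderiv ℝ a k (b k, -a k)
    - m * (cs ε k.1 / sn ε k.1) * a k = H
  param : ∀ k ∈ S, a k ^ 2 + b k ^ 2 = 1 → ∃ δ > 0, ∃ γ v : ℝ → ℝ × ℝ, γ 0 = k ∧
    (∀ s ∈ Ioo (-δ) δ, γ s ∈ S ∧ HasDerivAt γ (v s) s ∧ v s ≠ 0 ∧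
      a (γ s) * (v s).1 + b (γ s) * (v s).2 = 0) ∧
    ∀ η > 0, ∀ᶠ k' in 𝓝 k, k' ∈ S → ∃ s ∈ Ioo (-η) η, γ s = k'

/-- The point `k` is on the profile curve of the sphere of mean curvature `H`, the lowest point
of which has height `d`, and `(a, b)` is the normal of that curve. -/
def OnProfile (m : ℕ) (ε R H : ℝ) (a b : ℝ × ℝ → ℝ) (d : ℝ) (k : ℝ × ℝ) : Prop :=
  ∃ θ ∈ Icc 0 Real.pi, k.1 ∈ Icc 0 R ∧ H * ratio m ε k.1 = Real.sin θ ∧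
    k.2 = height m ε R H θ + d ∧ a k = -Real.sin θ ∧ b k = Real.cos θ

variable {S : Set (ℝ × ℝ)} {a b : ℝ × ℝ → ℝ}

/-- Tangency forces v = l (b, -a). Differentiating a² + b² = 1 gives one linear relation for the
derivative of the normal, and the mean curvature equation gives the other. -/
lemma IsProfile.ode (hS : IsProfile m ε H S a b) {γ : ℝ → ℝ × ℝ} {v : ℝ × ℝ} {s : ℝ}
    (hmem : ∀ᶠ x in 𝓝 s, γ x ∈ S) (hd : HasDerivAt γ v s) (hv : v ≠ 0)
    (htan : a (γ s) * v.1 + b (γ s) * v.2 = 0) (hsn : sn ε (γ s).1 ≠ 0) :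
    ∃ l : ℝ, l ≠ 0 ∧ HasDerivAt (fun x => (γ x).1) (l * b (γ s)) s ∧
      HasDerivAt (fun x => (γ x).2) (-(l * a (γ s))) s ∧
      HasDerivAt (fun x => a (γ x)) (-(l * b (γ s) *
        (H + m * (cs ε (γ s).1 / sn ε (γ s).1) * a (γ s)))) s ∧
      HasDerivAt (fun x => b (γ x)) (l * a (γ s) *
        (H + m * (cs ε (γ s).1 / sn ε (γ s).1) * a (γ s))) s := by
  have hsS := hmem.self_of_nhds
  have hu := hS.unit _ hsS hsn
  have hκ := hS.curv _ hsS hsn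
  set A := a (γ s) with hA
  set B := b (γ s) with hB
  set l := B * v.1 - A * v.2 with hl
  have hv1 : v.1 = l * B := by rw [hl]; linear_combination (-v.1) * hu + A * htan
  have hv2 : v.2 = -(l * A) := by rw [hl]; linear_combination (-v.2) * hu + B * htan
  have hl0 : l ≠ 0 := fun h0 => hv (Prod.ext (by simp [hv1, h0]) (by simp [hv2, h0]))
  have hv' : v = l • (B, -A) := Prod.ext (by simp [hv1]) (by simp [hv2])
  have hda : HasDerivAt (fun x => a (γ x)) (l * fderiv ℝ a (γ s) (B, -A)) s := by
    have := (hS.diff_fst _ hsS).hasFDerivAt.comp_hasDerivAt s hd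
    rwa [hv', map_smul, smul_eq_mul] at this
  have hdb : HasDerivAt (fun x => b (γ x)) (l * fderiv ℝ b (γ s) (B, -A)) s := by
    have := (hS.diff_snd _ hsS).hasFDerivAt.comp_hasDerivAt s hd
    rwa [hv', map_smul, smul_eq_mul] at this
  have hortho : A * fderiv ℝ a (γ s) (B, -A) + B * fderiv ℝ b (γ s) (B, -A) = 0 := by
    have h1 := (hda.pow 2).add (hdb.pow 2)
    have h2 : ∀ᶠ x in 𝓝 s, a (γ x) ^ 2 + b (γ x) ^ 2 = 1 := by
      have hne : ∀ᶠ x in 𝓝 s, sn ε (γ x).1 ≠ 0 :=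
        (((continuous_sn ε).comp continuous_fst).continuousAt.comp
          hd.continuousAt).eventually_ne hsn
      filter_upwards [hmem, hne] with x hx hx'
      exact hS.unit _ hx hx'
    have h3 : HasDerivAt (fun x => a (γ x) ^ 2 + b (γ x) ^ 2) 0 s :=
      (hasDerivAt_const s (1 : ℝ)).congr_of_eventuallyEq h2
    have h4 := h1.unique h3
    simp only [Nat.cast_ofNat, Nat.add_one_sub_one, pow_one] at h4
    have h5 : l * (A * fderiv ℝ a (γ s) (B, -A) + B * fderiv ℝ b (γ s) (B, -A)) = 0 := by
      linarith
    exact (mul_eq_zero.1 h5).resolve_left hl0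
  have h1 : HasDerivAt (fun x => (γ x).1) v.1 s := hd.fst
  have h2 : HasDerivAt (fun x => (γ x).2) v.2 s := hd.snd
  refine ⟨l, hl0, by rwa [hv1] at h1, by rwa [hv2] at h2, ?_, ?_⟩
  · convert! hda using 1
    linear_combination (l * fderiv ℝ a (γ s) (B, -A)) * hu - l * A * hortho + l * B * hκ
  · convert! hdb using 1
    linear_combination (l * fderiv ℝ b (γ s) (B, -A)) * hu - l * B * hortho - l * A * hκ

/-- The openness half of the uniqueness argument: nearby points are reached along the local curve
through k₀, on which `exists_angle` applies even when k₀ is on the axis. -/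
lemma IsProfile.eventually_onProfile (hS : IsProfile m ε H S a b) (h : AdmissibleCurv m ε R H)
    {k₀ : ℝ × ℝ} {d : ℝ} (hk₀ : k₀ ∈ S) (hon : OnProfile m ε R H a b d k₀) :
    ∀ᶠ k in 𝓝 k₀, k ∈ S → 0 ≤ k.1 → OnProfile m ε R H a b d k := by
  have hon' := hon
  obtain ⟨θ₀, hθ₀, hr0, hsin, ht0, ha0, hb0⟩ := hon
  have hu0 : a k₀ ^ 2 + b k₀ ^ 2 = 1 := by rw [ha0, hb0, neg_sq, Real.sin_sq_add_cos_sq]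
  obtain ⟨δ, hδ, γ, v, hγ0, hγ, hcov⟩ := hS.param k₀ hk₀ hu0
  have h0δ : (0 : ℝ) ∈ Ioo (-δ) δ := ⟨by linarith, hδ⟩
  have hγc : ContinuousAt γ 0 := (hγ 0 h0δ).2.1.continuousAt
  -- The strict inequality `lt_ratio` keeps the curve off the cylinder r = R, so neighbouring points
  -- stay within it.
  have hrR : k₀.1 < R := by
    rw [← h.strictMonoOn_ratio.lt_iff_lt hr0 h.R_mem]
    refine lt_of_le_of_lt ?_ h.lt_ratio
    rw [le_div_iff₀ h.H_pos, mul_comm, hsin]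
    exact Real.sin_le_one _
  have e1 : ∀ᶠ s in 𝓝 (0 : ℝ), (γ s).1 < R := by
    have : ContinuousAt (fun s => (γ s).1) 0 := hγc.fst
    exact this.eventually_lt_const (by simpa [hγ0] using hrR)
  have e2 : ∀ᶠ s in 𝓝 (0 : ℝ), 0 < b (γ s) * Real.cos θ₀ - a (γ s) * Real.sin θ₀ := by
    have hb : ContinuousAt (fun s => b (γ s)) 0 :=
      ContinuousAt.comp (f := γ) (by rw [hγ0]; exact (hS.diff_snd _ hk₀).continuousAt) hγc
    have ha : ContinuousAt (fun s => a (γ s)) 0 :=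
      ContinuousAt.comp (f := γ) (by rw [hγ0]; exact (hS.diff_fst _ hk₀).continuousAt) hγc
    have : ContinuousAt (fun s => b (γ s) * Real.cos θ₀ - a (γ s) * Real.sin θ₀) 0 :=
      (hb.mul continuousAt_const).sub (ha.mul continuousAt_const)
    refine this.eventually_const_lt ?_
    change 0 < b (γ 0) * Real.cos θ₀ - a (γ 0) * Real.sin θ₀
    rw [hγ0, ha0, hb0]
    nlinarith [Real.sin_sq_add_cos_sq θ₀]
  -- If k₀ is on the axis, the normal there is vertical, so the curve crosses the axis transversally
  -- and meets it only at s = 0 nearby.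
  have e3 : ∀ᶠ s in 𝓝 (0 : ℝ), s ≠ 0 → (γ s).1 ≠ 0 := by
    rcases hr0.1.eq_or_lt with hz | hpos
    · have hsz : Real.sin θ₀ = 0 := by rw [← hsin, ← hz]; simp
      obtain ⟨-, hd, hv, htan⟩ := hγ 0 h0δ
      rw [hγ0, ha0, hb0, hsz] at htan
      have hc0 : Real.cos θ₀ ≠ 0 := fun hc => by
        have := Real.sin_sq_add_cos_sq θ₀
        rw [hsz, hc] at this
        norm_num at this
      have hv2 : (v 0).2 = 0 := by simpa [hc0] using htan
      have hv1 : (v 0).1 ≠ 0 := fun h1 => hv (Prod.ext h1 hv2)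
      have hd1 : HasDerivAt (fun s => (γ s).1) (v 0).1 0 := hd.fst
      have := hd1.eventually_ne hv1 (c := 0)
      rw [eventually_nhdsWithin_iff] at this
      exact this
    · have : ContinuousAt (fun s => (γ s).1) 0 := hγc.fst
      filter_upwards [this.eventually_ne (by simpa [hγ0] using hpos.ne' : (γ 0).1 ≠ 0)]
        with s hs _ using hs
  obtain ⟨η, hη, hball⟩ := Metric.eventually_nhds_iff.1 ((e1.and e2).and e3)
  filter_upwards [hcov (min η δ) (lt_min hη hδ)] with k hk hkS hk0
  obtain ⟨s, hs, rfl⟩ := hk hkS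
  rcases eq_or_ne s 0 with rfl | hs0
  · rwa [hγ0]
  have hsabs : |s| < min η δ := abs_lt.2 hs
  have hsx : ∀ x ∈ Icc (0 : ℝ) 1, |s * x| < min η δ := fun x hx => by
    rw [abs_mul, abs_of_nonneg hx.1]
    exact lt_of_le_of_lt (mul_le_of_le_one_right (abs_nonneg _) hx.2) hsabs
  have hη' : ∀ x ∈ Icc (0 : ℝ) 1, dist (s * x) 0 < η := fun x hx => by
    rw [Real.dist_0_eq_abs]; exact (hsx x hx).trans_le (min_le_left _ _)
  have hδ' : ∀ x ∈ Icc (0 : ℝ) 1, s * x ∈ Ioo (-δ) δ := fun x hx =>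
    abs_lt.1 ((hsx x hx).trans_le (min_le_right _ _))
  have hγcx : ContinuousOn (fun x => γ (s * x)) (Icc 0 1) := fun x hx => by
    refine ContinuousAt.continuousWithinAt ?_
    exact ContinuousAt.comp (f := fun x => s * x) (hγ _ (hδ' x hx)).2.1.continuousAt
      (by fun_prop)
  -- The endpoint has nonnegative radius; a nonpositive value earlier would create an axis point at
  -- a nonzero parameter.
  have hpos : ∀ x ∈ Ioc (0 : ℝ) 1, 0 < (γ (s * x)).1 := by
    intro x hx
    by_contra! hneg
    have hsub : Icc x 1 ⊆ Icc (0 : ℝ) 1 := Icc_subset_Icc hx.1.le le_rfl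
    have := intermediate_value_Icc hx.2
      ((continuous_fst.comp_continuousOn hγcx).mono hsub)
    obtain ⟨y, hy, hy0⟩ := this ⟨hneg, by simpa using hk0⟩
    exact (hball (hη' y (hsub hy))).2 (mul_ne_zero hs0 (hx.1.trans_le hy.1).ne') hy0
  have hrx : ∀ x ∈ Ioc (0 : ℝ) 1, (γ (s * x)).1 ∈ Ioc 0 R := fun x hx =>
    ⟨hpos x hx, (hball (hη' x (Ioc_subset_Icc_self hx))).1.1.le⟩
  have key := h.exists_angle (r := fun x => (γ (s * x)).1) (t := fun x => (γ (s * x)).2)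
    (α := fun x => a (γ (s * x))) (β := fun x => b (γ (s * x))) (d := d) hθ₀
    (continuous_fst.comp_continuousOn hγcx) (continuous_snd.comp_continuousOn hγcx)
    (fun x hx => ContinuousAt.comp_continuousWithinAt (f := fun x => γ (s * x))
      (hS.diff_fst _ (hγ _ (hδ' x hx)).1).continuousAt (hγcx x hx))
    (fun x hx => ContinuousAt.comp_continuousWithinAt (f := fun x => γ (s * x))
      (hS.diff_snd _ (hγ _ (hδ' x hx)).1).continuousAt (hγcx x hx))
    hrx
    (fun x hx => hS.unit _ (hγ _ (hδ' x (Ioc_subset_Icc_self hx))).1 (h.sn_ne (hrx x hx)))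
    (fun x hx => (hball (hη' x hx)).1.2)
    (by
      intro x hx
      have hx' : x ∈ Icc (0 : ℝ) 1 := ⟨hx.1.le, hx.2.le⟩
      obtain ⟨-, hd, hv, htan⟩ := hγ _ (hδ' x hx')
      obtain ⟨l, -, h1, h2, h3, h4⟩ := hS.ode
        (by
          filter_upwards [isOpen_Ioo.mem_nhds (hδ' x hx')] with y hy using (hγ y hy).1)
        hd hv htan (h.sn_ne (hrx x ⟨hx.1, hx.2.le⟩))
      have hsd : HasDerivAt (fun x => s * x) s x := by
        simpa using (hasDerivAt_id x).const_mul s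
      refine ⟨l * s, ?_, ?_, ?_, ?_⟩
      · convert! h1.comp x hsd using 1
        ring
      · convert! h2.comp x hsd using 1
        ring
      · convert! h3.comp x hsd using 1
        ring
      · convert! h4.comp x hsd using 1
        ring)
    (by simpa [hγ0] using hsin) (by simpa [hγ0] using hr0) (by simpa [hγ0] using ht0)
    (by simpa [hγ0] using ha0) (by simpa [hγ0] using hb0)
  simp only [mul_one] at key
  obtain ⟨θ, hθ, h1, h2, h3, h4⟩ := key
  refine ⟨θ, hθ, ?_, h1, h2, h3, h4⟩
  have := hrx 1 (by simp)
  rw [mul_one] at this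
  exact Ioc_subset_Icc_self this

/-- Recovering θ as arccos b removes the existential and leaves conditions that are visibly closed.
-/
lemma onProfile_iff (h : AdmissibleCurv m ε R H) {d : ℝ} {k : ℝ × ℝ} :
    OnProfile m ε R H a b d k ↔ k.1 ∈ Icc 0 R ∧ a k = -(H * ratio m ε k.1) ∧
      a k ^ 2 + b k ^ 2 = 1 ∧ k.2 = height m ε R H (Real.arccos (b k)) + d := by
  constructor
  · rintro ⟨θ, hθ, h1, h2, h3, h4, h5⟩
    refine ⟨h1, by rw [h2, h4], by rw [h4, h5, neg_sq, Real.sin_sq_add_cos_sq], ?_⟩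
    rw [h5, Real.arccos_cos hθ.1 hθ.2, h3]
  · rintro ⟨h1, h2, h3, h4⟩
    have hb : -1 ≤ b k ∧ b k ≤ 1 := abs_le.1 (abs_le_one_iff_mul_self_le_one.2 (by
      nlinarith [sq_nonneg (a k)]))
    have hs : Real.sin (Real.arccos (b k)) = H * ratio m ε k.1 := by
      rw [Real.sin_arccos, show 1 - b k ^ 2 = (H * ratio m ε k.1) ^ 2 by rw [← h3, h2]; ring,
        Real.sqrt_sq (mul_nonneg h.H_pos.le (h.ratio_nonneg h1))]
    exact ⟨Real.arccos (b k), ⟨Real.arccos_nonneg _, Real.arccos_le_pi _⟩, h1, hs.symm, h4,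
      by rw [hs, h2], by rw [Real.cos_arccos hb.1 hb.2]⟩

/-- Uniqueness: a connected profile that has one point in common with the profile curve of a
sphere, with the same normal, is contained in that curve. -/
lemma IsProfile.forall_onProfile (hS : IsProfile m ε H S a b) (h : AdmissibleCurv m ε R H)
    {K : Set (ℝ × ℝ)} (hKS : K ⊆ S) (hK0 : ∀ k ∈ K, 0 ≤ k.1) (hK : IsPreconnected K)
    {k₀ : ℝ × ℝ} {d : ℝ} (hk₀ : k₀ ∈ K) (hon : OnProfile m ε R H a b d k₀) :
    ∀ k ∈ K, OnProfile m ε R H a b d k := by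
  have : PreconnectedSpace K := Subtype.preconnectedSpace hK
  have hac : Continuous fun k : K => a k :=
    continuous_iff_continuousAt.2 fun k =>
      ContinuousAt.comp (f := fun k : K => (k : ℝ × ℝ))
        (hS.diff_fst _ (hKS k.2)).continuousAt continuousAt_subtype_val
  have hbc : Continuous fun k : K => b k :=
    continuous_iff_continuousAt.2 fun k =>
      ContinuousAt.comp (f := fun k : K => (k : ℝ × ℝ))
        (hS.diff_snd _ (hKS k.2)).continuousAt continuousAt_subtype_val
  have hclopen : IsClopen {k : K | OnProfile m ε R H a b d k} := by
    constructor
    · simp only [onProfile_iff h]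
      have hc1 : IsClosed {k : K | (k : ℝ × ℝ).1 ∈ Icc 0 R} :=
        isClosed_Icc.preimage (continuous_fst.comp continuous_subtype_val)
      have hc2 : IsClosed ({k : K | (k : ℝ × ℝ).1 ∈ Icc 0 R} ∩
          (fun k : K => a k + H * ratio m ε (k : ℝ × ℝ).1) ⁻¹' {0}) := by
        refine ContinuousOn.preimage_isClosed_of_isClosed ?_ hc1 isClosed_singleton
        refine hac.continuousOn.add (continuousOn_const.mul (h.continuousOn_ratio.comp
          (continuous_fst.comp continuous_subtype_val).continuousOn fun k hk => hk))
      have hc3 : IsClosed {k : K | a k ^ 2 + b k ^ 2 = 1} :=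
        isClosed_eq ((hac.pow 2).add (hbc.pow 2)) continuous_const
      have hc4 : IsClosed {k : K | (k : ℝ × ℝ).2 = height m ε R H (Real.arccos (b k)) + d} := by
        refine isClosed_eq (continuous_snd.comp continuous_subtype_val) (Continuous.add ?_
          continuous_const)
        exact h.continuousOn_height.comp_continuous (Real.continuous_arccos.comp hbc)
          fun k => ⟨Real.arccos_nonneg _, Real.arccos_le_pi _⟩
      convert! (hc2.inter hc3).inter hc4 using 1
      ext k
      simp only [mem_ofPred_eq, mem_inter_iff, mem_preimage, mem_singleton_iff,
        eq_neg_iff_add_eq_zero]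
      tauto
    · rw [isOpen_iff_mem_nhds]
      intro k hk
      have := hS.eventually_onProfile h (hKS k.2) hk
      have h2 := continuous_subtype_val.continuousAt.eventually this
      filter_upwards [h2] with k' hk'
      exact hk' (hKS k'.2) (hK0 _ k'.2)
  have huniv := hclopen.eq_univ ⟨⟨k₀, hk₀⟩, hon⟩
  intro k hk
  have : (⟨k, hk⟩ : K) ∈ {k : K | OnProfile m ε R H a b d k} := huniv ▸ mem_univ _
  exact this

/-- The profile curve of the sphere of mean curvature `H` whose lowest point has height `d`. -/
def profileCurve (m : ℕ) (ε R H d : ℝ) : Set (ℝ × ℝ) :=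
  {k | k.1 ∈ Icc 0 R ∧ ∃ θ ∈ Icc 0 Real.pi, H * ratio m ε k.1 = Real.sin θ ∧
    k.2 = height m ε R H θ + d}

/-- Take a minimum of b = cos θ on the compact set K. For 0 < θ < π the point is off the axis and b
has nonzero derivative l a H `ratioDeriv` along the curve, so it is not a minimum; θ = 0 would make
K a single point. Thus the curve closes up at the top. -/
lemma IsProfile.exists_snd_eq_neg_one (hS : IsProfile m ε H S a b)
    (h : AdmissibleCurv m ε R H) {K : Set (ℝ × ℝ)} (hKS : K ⊆ S)
    (hSK : ∀ k ∈ S, 0 ≤ k.1 → k.1 ≤ R → k ∈ K) (hKc : IsCompact K) (hKn : K.Nontrivial) {d : ℝ}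
    (hon : ∀ k ∈ K, OnProfile m ε R H a b d k) : ∃ k ∈ K, b k = -1 := by
  have hbc : ContinuousOn b K := fun k hk => (hS.diff_snd _ (hKS hk)).continuousAt.continuousWithinAt
  obtain ⟨k, hk, hmin⟩ := hKc.exists_isMinOn hKn.nonempty hbc
  refine ⟨k, hk, ?_⟩
  obtain ⟨θ, hθ, hr, hsin, ht, ha, hb⟩ := hon k hk
  rcases hθ.2.eq_or_lt with rfl | hθπ
  · rw [hb, Real.cos_pi]
  exfalso
  rcases hθ.1.eq_or_lt with rfl | hθ0
  · rw [Real.cos_zero] at hb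
    have hall : ∀ k' ∈ K, k' = (0, d) := by
      intro k' hk'
      obtain ⟨θ', hθ', hr', hsin', ht', ha', hb'⟩ := hon k' hk'
      have h1 : b k ≤ b k' := hmin hk'
      have h2 : Real.cos θ' = 1 := le_antisymm (Real.cos_le_one _) (by linarith)
      have h3 : θ' = 0 := by
        rwa [Real.cos_eq_one_iff_of_lt_of_lt (by linarith [hθ'.1, Real.pi_pos])
          (by linarith [hθ'.2, Real.pi_pos])] at h2
      rw [h3, Real.sin_zero, mul_eq_zero, or_iff_right h.H_pos.ne'] at hsin'
      have h4 : k'.1 = 0 := h.strictMonoOn_ratio.injOn hr' h.zero_mem (by rw [hsin', ratio_zero])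
      exact Prod.ext h4 (by rw [ht', h3, height_zero, zero_add])
    obtain ⟨x, hx, y, hy, hxy⟩ := hKn
    exact hxy ((hall x hx).trans (hall y hy).symm)
  · have hs := Real.sin_pos_of_mem_Ioo ⟨hθ0, hθπ⟩
    have hr0 : 0 < k.1 := by
      refine lt_of_le_of_ne hr.1 fun he => ?_
      rw [← he, ratio_zero, mul_zero] at hsin
      exact hs.ne hsin
    have hrR : k.1 < R := by
      rw [← h.strictMonoOn_ratio.lt_iff_lt hr h.R_mem]
      refine lt_of_le_of_lt ?_ h.lt_ratio
      rw [le_div_iff₀ h.H_pos, mul_comm, hsin]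
      exact Real.sin_le_one _
    have hu : a k ^ 2 + b k ^ 2 = 1 := by rw [ha, hb, neg_sq, Real.sin_sq_add_cos_sq]
    obtain ⟨δ, hδ, γ, v, hγ0, hγ, -⟩ := hS.param k (hKS hk) hu
    have h0δ : (0 : ℝ) ∈ Ioo (-δ) δ := ⟨by linarith, hδ⟩
    have hnS : ∀ᶠ s in 𝓝 (0 : ℝ), γ s ∈ S := by
      filter_upwards [isOpen_Ioo.mem_nhds h0δ] with s hs using (hγ s hs).1
    obtain ⟨-, hd, hv, htan⟩ := hγ 0 h0δ
    have hrk : (γ 0).1 ∈ Ioc 0 R := by rw [hγ0]; exact ⟨hr0, hr.2⟩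
    obtain ⟨l, hl, -, -, -, h4⟩ := hS.ode hnS hd hv htan (h.sn_ne hrk)
    have hmin' : IsLocalMin (fun s => b (γ s)) 0 := by
      have hc : ContinuousAt (fun s => (γ s).1) 0 := hd.continuousAt.fst
      filter_upwards [hnS, hc.eventually_const_lt (u := 0) (by simpa [hγ0] using hr0),
        hc.eventually_lt_const (u := R) (by simpa [hγ0] using hrR)] with s h1 h2 h3
      rw [hγ0]
      exact hmin (hSK _ h1 (h2 : 0 < (γ s).1).le (h3 : (γ s).1 < R).le)
    have hz := hmin'.hasDerivAt_eq_zero h4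
    rw [hγ0, ha] at hz
    have hκ : H + m * (cs ε k.1 / sn ε k.1) * -Real.sin θ = H * ratioDeriv m ε k.1 := by
      rw [← hsin, ratioDeriv]; ring
    rw [hκ] at hz
    exact absurd hz (by
      simp only [mul_eq_zero, not_or, neg_eq_zero]
      exact ⟨⟨hl, hs.ne'⟩, h.H_pos.ne', (h.ratioDeriv_pos (r := k.1) ⟨hr0, hr.2⟩).ne'⟩)

/-- A compact connected profile whose lowest point is on the axis is the profile curve of the
sphere. -/
theorem IsProfile.eq_profileCurve (hS : IsProfile m ε H S a b)
    (h : AdmissibleCurv m ε R H) {K : Set (ℝ × ℝ)} (hKS : K ⊆ S) (hK0 : ∀ k ∈ K, 0 ≤ k.1)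
    (hSK : ∀ k ∈ S, 0 ≤ k.1 → k.1 ≤ R → k ∈ K) (hKc : IsCompact K) (hKp : IsPreconnected K)
    (hKn : K.Nontrivial) {d : ℝ} (hd : (0, d) ∈ K) (hlow : ∀ k ∈ K, d ≤ k.2)
    (ha : a (0, d) = 0) (hb : b (0, d) ^ 2 = 1) : K = profileCurve m ε R H d := by
  have hpi := Real.pi_pos
  -- With the opposite normal, (0, d) would be the top of its profile curve as well as the lowest
  -- point of K, reducing K to a point.
  have hb1 : b (0, d) = 1 := by
    rcases mul_self_eq_one_iff.1 ((sq _).symm.trans hb) with hb | hb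
    · exact hb
    exfalso
    have hon := hS.forall_onProfile h hKS hK0 hKp (d := d - height m ε R H Real.pi) hd
      ⟨Real.pi, ⟨hpi.le, le_rfl⟩, h.zero_mem, by simp, by simp, by simp [ha], by simp [hb]⟩
    have hall : ∀ k ∈ K, k = (0, d) := by
      intro k hk
      obtain ⟨θ, hθ, hr, hsin, ht, -, -⟩ := hon k hk
      have h1 := hlow k hk
      have h2 : θ = Real.pi := by
        by_contra hne
        have := h.strictMonoOn_height hθ ⟨hpi.le, le_rfl⟩ (lt_of_le_of_ne hθ.2 hne)
        linarith
      rw [h2, Real.sin_pi, mul_eq_zero, or_iff_right h.H_pos.ne'] at hsin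
      have h4 : k.1 = 0 := h.strictMonoOn_ratio.injOn hr h.zero_mem (by rw [hsin, ratio_zero])
      exact Prod.ext h4 (by rw [ht, h2]; ring)
    obtain ⟨x, hx, y, hy, hxy⟩ := hKn
    exact hxy ((hall x hx).trans (hall y hy).symm)
  have hon := hS.forall_onProfile h hKS hK0 hKp (d := d) hd
    ⟨0, ⟨le_rfl, hpi.le⟩, h.zero_mem, by simp, by simp, by simp [ha], by simp [hb1]⟩
  have hbc : ContinuousOn b K :=
    fun k hk => (hS.diff_snd _ (hKS hk)).continuousAt.continuousWithinAt
  obtain ⟨k₁, hk₁, hbk₁⟩ := hS.exists_snd_eq_neg_one h hKS hSK hKc hKn hon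
  -- By connectedness b takes every value between -1 and 1 on K, and that value determines the point
  -- of the profile curve.
  have hord := (hKp.image b hbc).ordConnected
  ext k
  constructor
  · intro hk
    obtain ⟨θ, hθ, h1, h2, h3, -, -⟩ := hon k hk
    exact ⟨h1, θ, hθ, h2, h3⟩
  · rintro ⟨hr, θ, hθ, hsin, ht⟩
    obtain ⟨k', hk', hbk'⟩ := hord.out ⟨k₁, hk₁, hbk₁⟩ ⟨(0, d), hd, hb1⟩
      (⟨Real.neg_one_le_cos θ, Real.cos_le_one θ⟩ : Real.cos θ ∈ Icc (-1 : ℝ) 1)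
    obtain ⟨θ', hθ', hr', hsin', ht', -, hb'⟩ := hon k' hk'
    have he : θ' = θ := Real.injOn_cos hθ' hθ (hb'.symm.trans hbk')
    rw [he] at hsin' ht'
    have h1 : k'.1 = k.1 := h.strictMonoOn_ratio.injOn hr' hr
      (mul_left_cancel₀ h.H_pos.ne' (hsin'.trans hsin.symm))
    have h2 : k' = k := Prod.ext h1 (ht'.trans ht.symm)
    exact h2 ▸ hk'

end QProd

/-! ### The ambient form, reflections, and the distance from o. -/

namespace QProd

open Set Filter Topology

section Form

variable {n : ℕ} {ε : ℝ}

lemma form_comm (x y : Vec n) : form ε x y = form ε y x := by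
  unfold form; rw [real_inner_comm]; ring

lemma form_add_left (x y z : Vec n) : form ε (x + y) z = form ε x z + form ε y z := by
  unfold form; simp [inner_add_left]; ring

lemma form_add_right (x y z : Vec n) : form ε x (y + z) = form ε x y + form ε x z := by
  unfold form; simp [inner_add_right]; ring

lemma form_smul_left (c : ℝ) (x y : Vec n) : form ε (c • x) y = c * form ε x y := by
  unfold form; simp [inner_smul_left]; ring

lemma form_smul_right (c : ℝ) (x y : Vec n) : form ε x (c • y) = c * form ε x y := by
  unfold form; simp [inner_smul_right]; ring

lemma form_sub_left (x y z : Vec n) : form ε (x - y) z = form ε x z - form ε y z := by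
  unfold form; simp [inner_sub_left]; ring

lemma form_sub_right (x y z : Vec n) : form ε x (y - z) = form ε x y - form ε x z := by
  unfold form; simp [inner_sub_right]; ring

@[simp] lemma form_zero_left (x : Vec n) : form ε 0 x = 0 := by simp [form]

lemma form_sum_left {ι : Type*} (s : Finset ι) (x : ι → Vec n) (y : Vec n) :
    form ε (∑ i ∈ s, x i) y = ∑ i ∈ s, form ε (x i) y := by
  classical
  induction s using Finset.induction_on with
  | empty => simp
  | insert i s hi ih => rw [Finset.sum_insert hi, Finset.sum_insert hi, form_add_left, ih]

lemma continuous_form : Continuous fun p : Vec n × Vec n => form ε p.1 p.2 := by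
  unfold form; fun_prop

lemma hasDerivAt_form {x y : ℝ → Vec n} {x' y' : Vec n} {s : ℝ} (hx : HasDerivAt x x' s)
    (hy : HasDerivAt y y' s) :
    HasDerivAt (fun s => form ε (x s) (y s)) (form ε x' (y s) + form ε (x s) y') s := by
  have hx1 : HasDerivAt (fun s => (x s).1) x'.1 s := hx.fst
  have hx2 : HasDerivAt (fun s => (x s).2) x'.2 s := hx.snd
  have hy1 : HasDerivAt (fun s => (y s).1) y'.1 s := hy.fst
  have hy2 : HasDerivAt (fun s => (y s).2) y'.2 s := hy.snd
  have := ((hx1.mul hy1).const_mul ε).add (hx2.inner ℝ hy2)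
  convert! this using 1
  unfold form; ring

/-- The reflection in the hyperplane orthogonal to `d`. -/
noncomputable def refl (ε : ℝ) (d : Vec n) : Vec n →ₗ[ℝ] Vec n where
  toFun x := x - (2 * form ε x d / form ε d d) • d
  map_add' x y := by
    rw [form_add_left, mul_add, add_div, add_smul]; abel
  map_smul' c x := by
    rw [form_smul_left, RingHom.id_apply, smul_sub, smul_smul]; congr 2; ring

lemma refl_apply (d x : Vec n) : refl ε d x = x - (2 * form ε x d / form ε d d) • d := rfl

lemma form_refl {d : Vec n} (hd : form ε d d ≠ 0) (x y : Vec n) :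
    form ε (refl ε d x) (refl ε d y) = form ε x y := by
  simp only [refl_apply, form_sub_left, form_sub_right, form_smul_left, form_smul_right,
    form_comm d y]
  field_simp
  ring

lemma refl_refl {d : Vec n} (hd : form ε d d ≠ 0) (x : Vec n) :
    refl ε d (refl ε d x) = x := by
  simp only [refl_apply, form_sub_left, form_smul_left]
  rw [sub_sub, ← add_smul]
  have : 2 * form ε x d / form ε d d +
      2 * (form ε x d - 2 * form ε x d / form ε d d * form ε d d) / form ε d d = 0 := by
    field_simp; ring
  rw [this, zero_smul, sub_zero]

lemma refl_sub {p q : Vec n} (hd : form ε (p - q) (p - q) ≠ 0) (hpq : form ε p p = form ε q q) :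
    refl ε (p - q) p = q := by
  have : 2 * form ε p (p - q) / form ε (p - q) (p - q) = 1 := by
    rw [div_eq_one_iff_eq hd]
    simp only [form_sub_left, form_sub_right, form_comm q p]
    linarith
  rw [refl_apply, this, one_smul, sub_sub_cancel]

lemma refl_eq_self {d o : Vec n} (ho : form ε o d = 0) : refl ε d o = o := by
  simp [refl_apply, ho]

/-- `f` completes `o` to an orthonormal basis. -/
structure IsFrame (ε : ℝ) (o : Vec n) (f : Fin n → Vec n) : Prop where
  orthonormal : ∀ i j, form ε (f i) (f j) = if i = j then 1 else 0
  orthogonal : ∀ i, form ε o (f i) = 0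
  expand : ∀ x, x = (ε * form ε x o) • o + ∑ i, form ε x (f i) • f i

lemma isFrame_standard (hε : ε = -1 ∨ ε = 1) :
    IsFrame ε ((1, 0) : Vec n) fun i => (0, EuclideanSpace.basisFun (Fin n) ℝ i) where
  orthonormal i j := by
    unfold form
    simp only [mul_zero, zero_add]
    exact orthonormal_iff_ite.1 (EuclideanSpace.basisFun (Fin n) ℝ).orthonormal i j
  orthogonal i := by simp [form]
  expand x := by
    have hε2 : ε * ε = 1 := by rcases hε with rfl | rfl <;> norm_num
    refine Prod.ext ?_ ?_
    · have : (∑ i, form ε x (0, EuclideanSpace.basisFun (Fin n) ℝ i) •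
          ((0, EuclideanSpace.basisFun (Fin n) ℝ i) : Vec n)).1 = 0 := by
        rw [Prod.fst_sum]; simp
      rw [Prod.fst_add, this]
      simp [form, ← mul_assoc, hε2]
    · rw [Prod.snd_add, Prod.snd_sum]
      simp only [Prod.smul_snd, smul_zero, zero_add]
      have := (EuclideanSpace.basisFun (Fin n) ℝ).sum_repr x.2
      conv_lhs => rw [← this]
      refine Finset.sum_congr rfl fun i _ => ?_
      rw [(EuclideanSpace.basisFun (Fin n) ℝ).repr_apply_apply, form, real_inner_comm]
      simp

/-- The reflection exchanging (1, 0) and o carries the standard frame to one at o. It is defined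
because the form of (1, 0) - o with itself is 2ε(1 - o.1), which vanishes only when o = (1, 0). -/
lemma exists_isFrame (hε : ε = -1 ∨ ε = 1) {o : Vec n} (ho : form ε o o = ε) :
    ∃ f, IsFrame ε o f := by
  have hε0 : ε ≠ 0 := by rcases hε with rfl | rfl <;> norm_num
  have he : form ε ((1, 0) : Vec n) (1, 0) = ε := by simp [form]
  have hoe : form ε o ((1, 0) : Vec n) = ε * o.1 := by simp [form]
  by_cases h1 : o.1 = 1
  · have h2 : o.2 = 0 := by
      unfold form at ho
      rw [h1, mul_one, mul_one, add_eq_left, inner_self_eq_zero] at ho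
      exact ho
    have : o = (1, 0) := Prod.ext h1 h2
    exact ⟨_, this ▸ isFrame_standard hε⟩
  · have hd : form ε ((1, 0) - o) ((1, 0) - o) ≠ 0 := by
      simp only [form_sub_left, form_sub_right, he, ho, hoe, form_comm _ o]
      intro h
      apply h1
      have : ε * (o.1 - 1) = 0 := by linarith
      rcases mul_eq_zero.1 this with h | h
      · exact absurd h hε0
      · linarith
    have hro := refl_sub hd (he.trans ho.symm)
    set L := refl ε ((1, 0) - o)
    have hL : ∀ x y, form ε (L x) (L y) = form ε x y := form_refl hd
    have hLL : ∀ x, L (L x) = x := refl_refl hd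
    have hs := isFrame_standard (n := n) hε
    refine ⟨fun i => L (0, EuclideanSpace.basisFun (Fin n) ℝ i), ⟨fun i j => ?_, fun i => ?_,
      fun x => ?_⟩⟩
    · rw [hL]; exact hs.orthonormal i j
    · rw [← hro, hL]; exact hs.orthogonal i
    · have h1 := congrArg L (hs.expand (L x))
      rw [hLL, map_add, map_smul, map_sum, hro] at h1
      conv_lhs => rw [h1]
      congr 1
      · rw [← hL (L x), hLL, hro]
      · refine Finset.sum_congr rfl fun i _ => ?_
        rw [map_smul, ← hL (L x), hLL]

variable {o : Vec n} {f : Fin n → Vec n}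

lemma IsFrame.form_eq (hf : IsFrame ε o f) (x y : Vec n) :
    form ε x y = ε * (form ε x o * form ε y o) + ∑ i, form ε x (f i) * form ε y (f i) := by
  conv_lhs => rw [hf.expand x]
  rw [form_add_left, form_smul_left, form_sum_left, form_comm o y]
  congr 1
  · ring
  · refine Finset.sum_congr rfl fun i _ => ?_
    rw [form_smul_left, form_comm (f i) y]

lemma IsFrame.form_self (hf : IsFrame ε o f) (x : Vec n) :
    form ε x x = ε * form ε x o ^ 2 + ∑ i, form ε x (f i) ^ 2 := by
  rw [hf.form_eq]
  congr 1
  · ring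
  · exact Finset.sum_congr rfl fun i _ => by ring

lemma IsFrame.eq_zero (hf : IsFrame ε o f) {x : Vec n} (h0 : form ε x o = 0)
    (h : form ε x x = 0) : x = 0 := by
  rw [hf.form_self, h0] at h
  have h1 : ∑ i, form ε x (f i) ^ 2 = 0 := by linarith
  rw [Finset.sum_eq_zero_iff_of_nonneg fun i _ => sq_nonneg _] at h1
  rw [hf.expand x, h0]
  simp only [mul_zero, zero_smul, zero_add]
  exact Finset.sum_eq_zero fun i hi => by rw [pow_eq_zero_iff two_ne_zero |>.1 (h1 i hi), zero_smul]

lemma inner_lt_of_form {x y : Vec n} (hx : form (-1) x x = -1) (hy : form (-1) y y = -1) :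
    |inner ℝ x.2 y.2| < |x.1 * y.1| := by
  have h1 := abs_real_inner_le_norm x.2 y.2
  unfold form at hx hy
  rw [real_inner_self_eq_norm_sq] at hx hy
  refine lt_of_le_of_lt h1 ?_
  apply lt_of_pow_lt_pow_left₀ 2 (abs_nonneg _)
  rw [sq_abs, mul_pow, mul_pow]
  nlinarith [sq_nonneg ‖x.2‖, sq_nonneg ‖y.2‖]

/-- On the hyperboloid the time parts dominate the product of space parts, so the sign of the form
with o identifies the sheet, without reference to coordinates. -/
lemma mem_spaceForm_iff (ho : o ∈ spaceForm n ε) {x : Vec n} :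
    x ∈ spaceForm n ε ↔ form ε x x = ε ∧ (ε = -1 → 0 < ε * form ε o x) := by
  refine and_congr_right fun hx => forall_congr' fun hε => ?_
  subst hε
  have ho1 := ho.2 rfl
  have h1 := inner_lt_of_form ho.1 hx
  have h2 : (-1 : ℝ) * form (-1) o x = o.1 * x.1 - inner ℝ o.2 x.2 := by unfold form; ring
  rw [h2]
  constructor
  · intro h
    rw [abs_of_pos (mul_pos ho1 h)] at h1
    linarith [le_abs_self (inner ℝ o.2 x.2)]
  · intro h
    by_contra! hneg
    rw [abs_of_nonpos (mul_nonpos_of_nonneg_of_nonpos ho1.le hneg)] at h1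
    linarith [neg_abs_le (inner ℝ o.2 x.2)]

/-- The distance, in the space form, of `x` from `o`. -/
noncomputable def radius (ε : ℝ) (o x : Vec n) : ℝ :=
  if ε = 1 then Real.arccos (ε * form ε o x) else Real.arcosh (ε * form ε o x)

lemma form_bound (hε : ε = -1 ∨ ε = 1) (ho : o ∈ spaceForm n ε) {x : Vec n}
    (hx : x ∈ spaceForm n ε) :
    (ε = 1 → ε * form ε o x ∈ Icc (-1) 1) ∧ (ε = -1 → 1 ≤ ε * form ε o x) := by
  obtain ⟨f, hf⟩ := exists_isFrame hε ho.1
  have h1 := hf.form_self x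
  rw [hx.1, form_comm x o] at h1
  have h2 : 0 ≤ ∑ i, form ε x (f i) ^ 2 := Finset.sum_nonneg fun i _ => sq_nonneg _
  constructor
  · rintro rfl
    rw [one_mul]
    exact abs_le.1 ((sq_le_one_iff_abs_le_one _).1 (by linarith))
  · rintro rfl
    have h3 := ((mem_spaceForm_iff ho).1 hx).2 rfl
    nlinarith

lemma cs_radius (hε : ε = -1 ∨ ε = 1) (ho : o ∈ spaceForm n ε) {x : Vec n}
    (hx : x ∈ spaceForm n ε) : cs ε (radius ε o x) = ε * form ε o x := by
  have h := form_bound hε ho hx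
  rcases hε with rfl | rfl
  · have : ¬ ((-1 : ℝ) = 1) := by norm_num
    simp only [cs, radius, if_neg this]
    exact Real.cosh_arcosh (h.2 rfl)
  · simp only [cs, radius, if_pos]
    exact Real.cos_arccos (h.1 rfl).1 (h.1 rfl).2

lemma radius_nonneg (hε : ε = -1 ∨ ε = 1) (ho : o ∈ spaceForm n ε) {x : Vec n}
    (hx : x ∈ spaceForm n ε) : 0 ≤ radius ε o x := by
  have h := form_bound hε ho hx
  rcases hε with rfl | rfl
  · have : ¬ ((-1 : ℝ) = 1) := by norm_num
    simp only [radius, if_neg this]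
    exact Real.arcosh_nonneg (h.2 rfl)
  · simp only [radius, if_pos]
    exact Real.arccos_nonneg _

lemma radius_eq (hε : ε = -1 ∨ ε = 1) {x : Vec n} {r : ℝ} (hr : 0 ≤ r) (hr' : ε = 1 → r ≤ Real.pi)
    (h : ε * form ε o x = cs ε r) : radius ε o x = r := by
  rcases hε with rfl | rfl
  · have : ¬ ((-1 : ℝ) = 1) := by norm_num
    simp only [radius, if_neg this, h, cs]
    exact Real.arcosh_cosh hr
  · simp only [radius, if_pos, h, cs]
    exact Real.arccos_cos hr (hr' rfl)

lemma continuousOn_radius (hε : ε = -1 ∨ ε = 1) (ho : o ∈ spaceForm n ε) :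
    ContinuousOn (radius ε o) (spaceForm n ε) := by
  have hc : Continuous fun x : Vec n => ε * form ε o x :=
    continuous_const.mul (continuous_form.comp (continuous_const.prodMk continuous_id))
  rcases hε with rfl | rfl
  · have : ¬ ((-1 : ℝ) = 1) := by norm_num
    unfold radius
    simp only [if_neg this]
    exact Real.continuousOn_arcosh.comp hc.continuousOn
      fun x hx => (form_bound (Or.inl rfl) ho hx).2 rfl
  · unfold radius
    simp only [if_pos]
    exact (Real.continuous_arccos.comp hc).continuousOn

/-- Two points at the same distance from `o` are exchanged by an isometry fixing `o`. -/
lemma IsRotational.mem_iff (hε : ε = -1 ∨ ε = 1) (ho : form ε o o = ε) {S : Set (Amb n)}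
    (hS : IsRotational ε o S) {x y : Vec n} {t : ℝ} (hx : form ε x x = ε) (hy : form ε y y = ε)
    (hxy : form ε o x = form ε o y) : (x, t) ∈ S ↔ (y, t) ∈ S := by
  obtain ⟨f, hf⟩ := exists_isFrame hε ho
  suffices H : ∀ x y : Vec n, form ε x x = ε → form ε y y = ε → form ε o x = form ε o y →
      (x, t) ∈ S → (y, t) ∈ S from ⟨H x y hx hy hxy, H y x hy hx hxy.symm⟩
  intro x y hx hy hxy hxS
  by_cases hne : x - y = 0
  · rwa [← sub_eq_zero.1 hne]
  have h0 : form ε o (x - y) = 0 := by rw [form_sub_right, hxy, sub_self]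
  -- The form is definite on the orthogonal complement of o, so the reflection along x - y exists;
  -- it fixes o and takes x to y.
  have hd : form ε (x - y) (x - y) ≠ 0 := fun h =>
    hne (hf.eq_zero ((form_comm _ _).trans h0) h)
  have := hS (LinearEquiv.ofInvolutive (refl ε (x - y)) (refl_refl hd))
    (fun a b => form_refl hd a b) (refl_eq_self h0) _ hxS
  change (refl ε (x - y) x, t) ∈ S at this
  rwa [refl_sub hd (hx.trans hy.symm)] at this

end Form

/-! ### Meridian half-planes and the meridian section of a hypersurface. -/

section Meridian

variable {n : ℕ} {ε : ℝ} {o u : Vec n}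

/-- The geodesic issuing from `o` with initial velocity `u`. -/
noncomputable def geodesic (ε : ℝ) (o u : Vec n) (r : ℝ) : Vec n := cs ε r • o + sn ε r • u

/-- The velocity of `geodesic`. -/
noncomputable def radial (ε : ℝ) (o u : Vec n) (r : ℝ) : Vec n :=
  (-ε * sn ε r) • o + cs ε r • u

/-- The half-plane spanned by the axis and a geodesic issuing from `o`. -/
noncomputable def meridian (ε : ℝ) (o u : Vec n) (k : ℝ × ℝ) : Amb n :=
  (geodesic ε o u k.1, k.2)

lemma hasDerivAt_geodesic (hε : ε = -1 ∨ ε = 1) (r : ℝ) :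
    HasDerivAt (geodesic ε o u) (radial ε o u r) r :=
  ((hasDerivAt_cs hε r).smul_const o).add ((hasDerivAt_sn ε r).smul_const u)

lemma hasDerivAt_radial (hε : ε = -1 ∨ ε = 1) (r : ℝ) :
    HasDerivAt (radial ε o u) (-ε • geodesic ε o u r) r := by
  have := (((hasDerivAt_sn ε r).const_mul (-ε)).smul_const o).add
    ((hasDerivAt_cs hε r).smul_const u)
  convert! this using 1
  rw [geodesic, smul_add, smul_smul, smul_smul]

lemma contDiff_meridian {k : WithTop ℕ∞} : ContDiff ℝ k (meridian ε o u) := by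
  have h1 : ContDiff ℝ k fun p : ℝ × ℝ => cs ε p.1 := (contDiff_cs ε).comp contDiff_fst
  have h2 : ContDiff ℝ k fun p : ℝ × ℝ => sn ε p.1 := (contDiff_sn ε).comp contDiff_fst
  exact ((h1.smul contDiff_const).add (h2.smul contDiff_const)).prodMk contDiff_snd

lemma hasFDerivAt_meridian (hε : ε = -1 ∨ ε = 1) (k : ℝ × ℝ) :
    HasFDerivAt (meridian ε o u) (((ContinuousLinearMap.fst ℝ ℝ ℝ).smulRight
      (radial ε o u k.1)).prod (ContinuousLinearMap.snd ℝ ℝ ℝ)) k := by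
  have h1 := (hasDerivAt_geodesic (o := o) (u := u) hε k.1).hasFDerivAt.comp k
    (hasFDerivAt_fst (𝕜 := ℝ) (E := ℝ) (F := ℝ))
  have h2 := h1.prodMk (hasFDerivAt_snd (𝕜 := ℝ) (E := ℝ) (F := ℝ) (p := k))
  convert! h2 using 1

lemma hasDerivAt_meridian_comp (hε : ε = -1 ∨ ε = 1) {γ : ℝ → ℝ × ℝ} {v : ℝ × ℝ} {s : ℝ}
    (hγ : HasDerivAt γ v s) :
    HasDerivAt (fun s => meridian ε o u (γ s)) (v.1 • radial ε o u (γ s).1, v.2) s :=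
  (hasFDerivAt_meridian hε (γ s)).comp_hasDerivAt s hγ

lemma form_geodesic_self (hε : ε = -1 ∨ ε = 1) (ho : form ε o o = ε) (hu : form ε u u = 1)
    (hou : form ε o u = 0) (r : ℝ) : form ε (geodesic ε o u r) (geodesic ε o u r) = ε := by
  have h1 := cs_sq_add hε r
  have h2 : ε * ε = 1 := by rcases hε with rfl | rfl <;> norm_num
  simp only [geodesic, form_add_left, form_add_right, form_smul_left, form_smul_right, ho, hu,
    hou, form_comm u o]
  linear_combination ε * h1 - sn ε r ^ 2 * h2

lemma form_radial_self (hε : ε = -1 ∨ ε = 1) (ho : form ε o o = ε) (hu : form ε u u = 1)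
    (hou : form ε o u = 0) (r : ℝ) : form ε (radial ε o u r) (radial ε o u r) = 1 := by
  have h1 := cs_sq_add hε r
  have h2 : ε * ε = 1 := by rcases hε with rfl | rfl <;> norm_num
  simp only [radial, form_add_left, form_add_right, form_smul_left, form_smul_right, ho, hu,
    hou, form_comm u o]
  linear_combination h1 + ε * sn ε r ^ 2 * h2

lemma form_geodesic_radial (hε : ε = -1 ∨ ε = 1) (ho : form ε o o = ε) (hu : form ε u u = 1)
    (hou : form ε o u = 0) (r : ℝ) : form ε (geodesic ε o u r) (radial ε o u r) = 0 := by
  have h2 : ε * ε = 1 := by rcases hε with rfl | rfl <;> norm_num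
  simp only [radial, geodesic, form_add_left, form_add_right, form_smul_left, form_smul_right,
    ho, hu, hou, form_comm u o]
  linear_combination -(cs ε r * sn ε r) * h2

lemma form_geodesic (ho : form ε o o = ε) (hou : form ε o u = 0) (r : ℝ) :
    form ε o (geodesic ε o u r) = ε * cs ε r := by
  simp only [geodesic, form_add_right, form_smul_right, ho, hou]
  ring

lemma cs_pos_of_neg_one (r : ℝ) : 0 < cs (-1) r := by
  unfold cs; norm_num [Real.cosh_pos]

lemma geodesic_mem (hε : ε = -1 ∨ ε = 1) (ho : o ∈ spaceForm n ε) (hu : form ε u u = 1)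
    (hou : form ε o u = 0) (r : ℝ) : geodesic ε o u r ∈ spaceForm n ε := by
  refine (mem_spaceForm_iff ho).2 ⟨form_geodesic_self hε ho.1 hu hou r, ?_⟩
  rintro rfl
  rw [form_geodesic ho.1 hou]
  linarith [cs_pos_of_neg_one r]

variable {S : Set (Amb n)} {N : Amb n → Amb n} {H : ℝ}

/-- The velocity of a curve in a hypersurface is tangent to it. -/
lemma IsHypersurface.tangent_curve (hS : IsHypersurface ε S N) {γ : ℝ → Amb n} {v : Amb n}
    {s : ℝ} (hmem : ∀ᶠ x in 𝓝 s, γ x ∈ S) (hd : HasDerivAt γ v s) :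
    v ∈ tangentTo ε (γ s) ∧ metric ε (N (γ s)) v = 0 := by
  have hsS := hmem.self_of_nhds
  have hv : v ∈ tangentTo ε (γ s) := by
    have h1 : HasDerivAt (fun x => (γ x).1) v.1 s := hd.fst
    have h2 := hasDerivAt_form (ε := ε) h1 h1
    have h3 : HasDerivAt (fun x => form ε (γ x).1 (γ x).1) 0 s := by
      refine (hasDerivAt_const s ε).congr_of_eventuallyEq ?_
      filter_upwards [hmem] with x hx using (hS.subset hx).1.1
    have h4 := h2.unique h3
    rw [form_comm v.1] at h4
    change form ε (γ s).1 v.1 = 0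
    linarith
  refine ⟨hv, ?_⟩
  obtain ⟨U, F, hU, hsU, hF, hlevel, c, hc, hgrad⟩ := hS.level_set _ hsS
  have hFd : DifferentiableAt ℝ F (γ s) :=
    (hF.contDiffAt (hU.mem_nhds hsU)).differentiableAt (by simp)
  have h1 := hFd.hasFDerivAt.comp_hasDerivAt s hd
  have h2 : HasDerivAt (F ∘ γ) 0 s := by
    refine (hasDerivAt_const s (0 : ℝ)).congr_of_eventuallyEq ?_
    filter_upwards [hmem, hd.continuousAt.eventually (hU.mem_nhds hsU)] with x hx hxU
    exact (hlevel _ hxU (hS.subset hx)).1 hx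
  have h3 := h1.unique h2
  rw [hgrad v hv, mul_eq_zero] at h3
  exact h3.resolve_left hc

/-- The radial component, along a meridian, of the normal. -/
noncomputable def radialPart (ε : ℝ) (o u : Vec n) (N : Amb n → Amb n) (k : ℝ × ℝ) : ℝ :=
  form ε (N (meridian ε o u k)).1 (radial ε o u k.1)

/-- The vertical component, along a meridian, of the normal. -/
noncomputable def verticalPart (ε : ℝ) (o u : Vec n) (N : Amb n → Amb n) (k : ℝ × ℝ) : ℝ :=
  (N (meridian ε o u k)).2

lemma metric_meridian (k v : ℝ × ℝ) :
    metric ε (N (meridian ε o u k)) (v.1 • radial ε o u k.1, v.2) =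
      radialPart ε o u N k * v.1 + verticalPart ε o u N k * v.2 := by
  simp only [metric, radialPart, verticalPart, form_smul_right]
  ring

/-- The meridian section of a hypersurface is locally a curve, wherever the normal is not
orthogonal to the meridian. -/
lemma IsHypersurface.exists_curve (hε : ε = -1 ∨ ε = 1) (hS : IsHypersurface ε S N)
    (ho : o ∈ spaceForm n ε) (hu : form ε u u = 1) (hou : form ε o u = 0) {k : ℝ × ℝ}
    (hk : meridian ε o u k ∈ S)
    (hab : radialPart ε o u N k ^ 2 + verticalPart ε o u N k ^ 2 ≠ 0) :
    ∃ δ > 0, ∃ γ v : ℝ → ℝ × ℝ, γ 0 = k ∧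
      (∀ s ∈ Ioo (-δ) δ, meridian ε o u (γ s) ∈ S ∧ HasDerivAt γ (v s) s ∧ v s ≠ 0 ∧
        radialPart ε o u N (γ s) * (v s).1 + verticalPart ε o u N (γ s) * (v s).2 = 0) ∧
      ∀ η > 0, ∀ᶠ k' in 𝓝 k, meridian ε o u k' ∈ S → ∃ s ∈ Ioo (-η) η, γ s = k' := by
  set a := radialPart ε o u N k with ha
  set b := verticalPart ε o u N k with hb
  obtain ⟨U, F, hU, hkU, hF, hlevel, c, hc, hgrad⟩ := hS.level_set _ hk
  have hspace : ∀ k', meridian ε o u k' ∈ space n ε := fun k' =>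
    ⟨geodesic_mem hε ho hu hou k'.1, mem_univ _⟩
  have hFc : ContDiffAt ℝ 1 F (meridian ε o u k) :=
    (hF.contDiffAt (hU.mem_nhds hkU)).of_le (by exact_mod_cast le_top)
  -- The second coordinate measures displacement along the tangent direction (b, -a). The Jacobian
  -- determinant at k is -c(a² + b²) ≠ 0, so Ψ is a local chart in which the section is the line
  -- where the first coordinate vanishes.
  set Ψ : ℝ × ℝ → ℝ × ℝ := fun k' => (F (meridian ε o u k'), b * k'.1 - a * k'.2) with hΨ
  have hΨc : ContDiffAt ℝ 1 Ψ k :=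
    (hFc.comp k contDiff_meridian.contDiffAt).prodMk (by fun_prop)
  let L₁ : ℝ × ℝ →L[ℝ] ℝ × ℝ :=
    ((c * a) • ContinuousLinearMap.fst ℝ ℝ ℝ + (c * b) • ContinuousLinearMap.snd ℝ ℝ ℝ).prod
      (b • ContinuousLinearMap.fst ℝ ℝ ℝ - a • ContinuousLinearMap.snd ℝ ℝ ℝ)
  let L₂ : ℝ × ℝ →L[ℝ] ℝ × ℝ :=
    ((a / (c * (a ^ 2 + b ^ 2))) • ContinuousLinearMap.fst ℝ ℝ ℝ +
      (b / (a ^ 2 + b ^ 2)) • ContinuousLinearMap.snd ℝ ℝ ℝ).prod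
      ((b / (c * (a ^ 2 + b ^ 2))) • ContinuousLinearMap.fst ℝ ℝ ℝ -
        (a / (a ^ 2 + b ^ 2)) • ContinuousLinearMap.snd ℝ ℝ ℝ)
  let L : (ℝ × ℝ) ≃L[ℝ] ℝ × ℝ := ContinuousLinearEquiv.equivOfInverse L₁ L₂
    (fun x => by
      refine Prod.ext ?_ ?_
      · simp [L₁, L₂]; field_simp; ring
      · simp [L₁, L₂]; field_simp; ring)
    (fun x => by
      refine Prod.ext ?_ ?_
      · simp [L₁, L₂]; field_simp; ring
      · simp [L₁, L₂]; field_simp; ring)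
  have hΨd : HasFDerivAt Ψ (L : ℝ × ℝ →L[ℝ] ℝ × ℝ) k := by
    have h1 := (hFc.differentiableAt one_ne_zero).hasFDerivAt.comp k
      (hasFDerivAt_meridian (o := o) (u := u) hε k)
    have h2 : HasFDerivAt (fun k' : ℝ × ℝ => b * k'.1 - a * k'.2)
        (b • ContinuousLinearMap.fst ℝ ℝ ℝ - a • ContinuousLinearMap.snd ℝ ℝ ℝ) k :=
      (hasFDerivAt_fst.const_mul b).sub (hasFDerivAt_snd.const_mul a)
    have h3 := h1.prodMk h2
    convert! h3 using 1
    refine ContinuousLinearMap.ext fun v => ?_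
    refine Prod.ext ?_ rfl
    have h4 := hgrad (v.1 • radial ε o u k.1, v.2) (by
      change form ε (geodesic ε o u k.1) (v.1 • radial ε o u k.1) = 0
      rw [form_smul_right, form_geodesic_radial hε ho.1 hu hou, mul_zero])
    rw [metric_meridian] at h4
    refine Eq.trans ?_ h4.symm
    simp [L, L₁]
    ring
  set e := hΨc.toOpenPartialHomeomorph Ψ hΨd one_ne_zero with he
  have hks : k ∈ e.source := hΨc.mem_toOpenPartialHomeomorph_source hΨd one_ne_zero
  have hkt : Ψ k ∈ e.target := e.map_source hks
  have hsymm : ContDiffAt ℝ 1 e.symm (Ψ k) := hΨc.to_localInverse hΨd one_ne_zero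
  have hFk : F (meridian ε o u k) = 0 := (hlevel _ hkU (hspace k)).1 hk
  set j : ℝ → ℝ × ℝ := fun s => (0, b * k.1 - a * k.2 + s) with hj
  have hj0 : j 0 = Ψ k := by simp [hj, hΨ, hFk]
  have hjc : Continuous j := by fun_prop
  have hjd : ∀ s, HasDerivAt j (0, 1) s := fun s =>
    (hasDerivAt_const s (0 : ℝ)).prodMk ((hasDerivAt_id s).const_add _)
  have hsk : e.symm (Ψ k) = k := e.left_inv hks
  have ev : ∀ᶠ y in 𝓝 (Ψ k), y ∈ e.target ∧ ContDiffAt ℝ 1 e.symm y ∧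
      meridian ε o u (e.symm y) ∈ U := by
    have : ContinuousAt (fun y => meridian ε o u (e.symm y)) (Ψ k) :=
      ContinuousAt.comp (f := e.symm) (contDiff_meridian (k := 1)).continuous.continuousAt
        hsymm.continuousAt
    have hkU' : meridian ε o u (e.symm (Ψ k)) ∈ U := by rwa [hsk]
    filter_upwards [e.open_target.mem_nhds hkt, hsymm.eventually (by simp),
      this.eventually (hU.mem_nhds hkU')] with y h1 h2 h3 using ⟨h1, h2, h3⟩
  have ev' : ∀ᶠ s in 𝓝 (0 : ℝ), j s ∈ e.target ∧ ContDiffAt ℝ 1 e.symm (j s) ∧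
      meridian ε o u (e.symm (j s)) ∈ U := by
    have := hjc.continuousAt (x := 0)
    rw [ContinuousAt, hj0] at this
    exact this.eventually ev
  obtain ⟨δ, hδ, hball⟩ := Metric.eventually_nhds_iff.1 ev'
  have hball' : ∀ s ∈ Ioo (-δ) δ, j s ∈ e.target ∧ ContDiffAt ℝ 1 e.symm (j s) ∧
      meridian ε o u (e.symm (j s)) ∈ U := fun s hs =>
    hball (by rw [Real.dist_0_eq_abs]; exact abs_lt.2 hs)
  have hS' : ∀ s ∈ Ioo (-δ) δ, meridian ε o u (e.symm (j s)) ∈ S := fun s hs => by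
    obtain ⟨h1, -, h3⟩ := hball' s hs
    refine (hlevel _ h3 (hspace _)).2 ?_
    have : Ψ (e.symm (j s)) = j s := e.right_inv h1
    exact congrArg Prod.fst this
  have hγd : ∀ s ∈ Ioo (-δ) δ, HasDerivAt (fun s => e.symm (j s))
      (fderiv ℝ e.symm (j s) (0, 1)) s := fun s hs =>
    ((hball' s hs).2.1.differentiableAt one_ne_zero).hasFDerivAt.comp_hasDerivAt s (hjd s)
  refine ⟨δ, hδ, fun s => e.symm (j s), fun s => fderiv ℝ e.symm (j s) (0, 1), ?_, ?_, ?_⟩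
  · simp only [hj0, hsk]
  · intro s hs
    have hd := hγd s hs
    refine ⟨hS' s hs, hd, fun h0 => ?_, ?_⟩
    · replace h0 : fderiv ℝ e.symm (j s) (0, 1) = 0 := h0
      rw [h0] at hd
      have h1 : HasDerivAt (fun s => (e.symm (j s)).1) 0 s := hd.fst
      have h2 : HasDerivAt (fun s => (e.symm (j s)).2) 0 s := hd.snd
      have h3 := (h1.const_mul b).sub (h2.const_mul a)
      have h4 : HasDerivAt (fun s => b * k.1 - a * k.2 + s) 1 s :=
        (hasDerivAt_id s).const_add _
      have h5 : HasDerivAt (fun s => b * (e.symm (j s)).1 - a * (e.symm (j s)).2) 1 s := by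
        refine h4.congr_of_eventuallyEq ?_
        filter_upwards [isOpen_Ioo.mem_nhds hs] with x hx
        have : Ψ (e.symm (j x)) = j x := e.right_inv (hball' x hx).1
        exact congrArg Prod.snd this
      have h6 := h5.unique h3
      simp at h6
    · have h1 := hasDerivAt_meridian_comp (o := o) (u := u) hε hd
      have h2 := (hS.tangent_curve (by
        filter_upwards [isOpen_Ioo.mem_nhds hs] with x hx using hS' x hx) h1).2
      rwa [metric_meridian] at h2
  · intro η hη
    have hcont : Continuous fun k' : ℝ × ℝ => b * k'.1 - a * k'.2 := by fun_prop
    have h1 : ∀ᶠ k' in 𝓝 k, b * k'.1 - a * k'.2 - (b * k.1 - a * k.2) ∈ Ioo (-η) η :=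
      (hcont.sub continuous_const).continuousAt.eventually
        (isOpen_Ioo.mem_nhds (by simp [hη]))
    have h2 : ∀ᶠ k' in 𝓝 k, meridian ε o u k' ∈ U :=
      (contDiff_meridian (k := 1)).continuous.continuousAt.eventually (hU.mem_nhds hkU)
    filter_upwards [h1, h2, e.open_source.mem_nhds hks] with k' h1 h2 h3 hk'
    refine ⟨_, h1, ?_⟩
    have : j (b * k'.1 - a * k'.2 - (b * k.1 - a * k.2)) = Ψ k' := by
      simp [hj, hΨ, (hlevel _ h2 (hspace k')).1 hk']
    simp only [this]
    exact e.left_inv h3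

end Meridian

end QProd

/-! ### The normal along orbits and meridians. -/

namespace QProd

open Set Filter Topology

section Curvature

variable {n : ℕ} {ε H : ℝ} {o u w : Vec n} {S : Set (Amb n)} {N : Amb n → Amb n}

lemma IsHypersurface.differentiableAt_normal (hS : IsHypersurface ε S N) {p : Amb n}
    (hp : p ∈ S) : DifferentiableAt ℝ N p :=
  (hS.smooth_normal p hp).differentiableAt (by simp)

lemma hasDerivAt_cos_smul_add (φ : ℝ) :
    HasDerivAt (fun φ : ℝ => Real.cos φ • u + Real.sin φ • w)
      (-Real.sin φ • u + Real.cos φ • w) φ :=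
  ((Real.hasDerivAt_cos φ).smul_const u).add ((Real.hasDerivAt_sin φ).smul_const w)

lemma hasDerivAt_neg_sin_smul_add (φ : ℝ) :
    HasDerivAt (fun φ : ℝ => -Real.sin φ • u + Real.cos φ • w)
      (-Real.cos φ • u + -Real.sin φ • w) φ :=
  ((Real.hasDerivAt_sin φ).neg.smul_const u).add ((Real.hasDerivAt_cos φ).smul_const w)

/-- The normal of a rotational hypersurface is orthogonal to the orbits, and its derivative along
them is determined by the position. -/
lemma IsHypersurface.normal_orbit (hε : ε = -1 ∨ ε = 1) (hS : IsHypersurface ε S N)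
    (ho : o ∈ spaceForm n ε) (hrot : IsRotational ε o S) (hu : form ε u u = 1)
    (hou : form ε o u = 0) (hw : form ε w w = 1) (how : form ε o w = 0) (huw : form ε u w = 0)
    {k : ℝ × ℝ} (hk : meridian ε o u k ∈ S) (hsn : sn ε k.1 ≠ 0) :
    form ε (N (meridian ε o u k)).1 w = 0 ∧
      sn ε k.1 * form ε (fderiv ℝ N (meridian ε o u k) (w, 0)).1 w =
        form ε (N (meridian ε o u k)).1 u := by
  -- Turning u towards w moves the point along its orbit. The normal is orthogonal to c' throughout;
  -- differentiating this at 0, where c'' = -u, gives the second claim.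
  set c : ℝ → Vec n := fun φ => Real.cos φ • u + Real.sin φ • w with hc
  set c' : ℝ → Vec n := fun φ => -Real.sin φ • u + Real.cos φ • w with hc'
  have hc0 : c 0 = u := by simp [hc]
  have hc0' : c' 0 = w := by simp [hc']
  have hcu : ∀ φ, form ε (c φ) (c φ) = 1 := fun φ => by
    simp only [hc, form_add_left, form_add_right, form_smul_left, form_smul_right, hu, hw, huw,
      form_comm w u]
    linear_combination Real.sin_sq_add_cos_sq φ
  have hco : ∀ φ, form ε o (c φ) = 0 := fun φ => by
    simp only [hc, form_add_right, form_smul_right, hou, how]; ring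
  have hmem : ∀ φ, meridian ε o (c φ) k ∈ S := fun φ => by
    refine (hrot.mem_iff hε ho.1 (form_geodesic_self hε ho.1 hu hou _)
      (form_geodesic_self hε ho.1 (hcu φ) (hco φ) _) ?_).1 hk
    rw [form_geodesic ho.1 hou, form_geodesic ho.1 (hco φ)]
  have hd : ∀ φ, HasDerivAt (fun φ => meridian ε o (c φ) k) (sn ε k.1 • c' φ, 0) φ := fun φ =>
    (((hasDerivAt_cos_smul_add φ).const_smul (sn ε k.1)).const_add (cs ε k.1 • o)).prodMk
      (hasDerivAt_const φ k.2)
  have hort : ∀ φ, form ε (N (meridian ε o (c φ) k)).1 (c' φ) = 0 := fun φ => by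
    have := (hS.tangent_curve (Eventually.of_forall hmem) (hd φ)).2
    simp only [metric, form_smul_right, mul_zero, add_zero] at this
    exact (mul_eq_zero.1 this).resolve_left hsn
  have h0 := hort 0
  rw [hc0, hc0'] at h0
  refine ⟨h0, ?_⟩
  have hN : HasDerivAt (fun φ => N (meridian ε o (c φ) k))
      (fderiv ℝ N (meridian ε o (c 0) k) (sn ε k.1 • c' 0, 0)) 0 :=
    (hS.differentiableAt_normal (hmem 0)).hasFDerivAt.comp_hasDerivAt 0 (hd 0)
  have hN1 : HasDerivAt (fun φ => (N (meridian ε o (c φ) k)).1) _ 0 := hN.fst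
  have h1 := hasDerivAt_form (ε := ε) hN1 (hasDerivAt_neg_sin_smul_add (u := u) (w := w) 0)
  have h2 : HasDerivAt (fun φ => form ε (N (meridian ε o (c φ) k)).1 (c' φ)) 0 0 := by
    simp only [hort]; exact hasDerivAt_const _ _
  have h3 := h1.unique h2
  have h4 : ((sn ε k.1 • w, 0) : Amb n) = sn ε k.1 • (w, 0) := by simp
  simp only [hc0, hc0', h4, map_smul, Real.cos_zero, Real.sin_zero, neg_zero, zero_smul,
    one_smul, zero_add, add_zero, Prod.smul_fst, form_smul_left, neg_smul] at h3
  have h5 : form ε (N (meridian ε o u k)).1 (-u) = -form ε (N (meridian ε o u k)).1 u := by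
    rw [← neg_one_smul ℝ u, form_smul_right]; ring
  rw [h5] at h3
  linarith

/-- The derivative of `radial` is a multiple of the position vector, to which the normal is
orthogonal; hence only the derivative of N contributes. -/
lemma IsHypersurface.hasDerivAt_radialPart (hε : ε = -1 ∨ ε = 1) (hS : IsHypersurface ε S N)
    {γ : ℝ → ℝ × ℝ} {v : ℝ × ℝ} {s : ℝ} (hmem : meridian ε o u (γ s) ∈ S)
    (hγ : HasDerivAt γ v s) :
    HasDerivAt (fun s => radialPart ε o u N (γ s))
      (form ε (fderiv ℝ N (meridian ε o u (γ s)) (v.1 • radial ε o u (γ s).1, v.2)).1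
        (radial ε o u (γ s).1)) s := by
  have hN := (hS.differentiableAt_normal hmem).hasFDerivAt.comp_hasDerivAt s
    (hasDerivAt_meridian_comp (o := o) (u := u) hε hγ)
  have hN1 : HasDerivAt (fun s => (N (meridian ε o u (γ s))).1) _ s := hN.fst
  have hγ1 : HasDerivAt (fun s => (γ s).1) v.1 s := hγ.fst
  have hr := (hasDerivAt_radial (o := o) (u := u) hε (γ s).1).scomp s hγ1
  have := hasDerivAt_form (ε := ε) hN1 hr
  convert! this using 1
  have h0 : form ε (geodesic ε o u (γ s).1) (N (meridian ε o u (γ s))).1 = 0 :=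
    hS.normal_tangent _ hmem
  rw [form_smul_right, form_smul_right, form_comm _ (geodesic ε o u (γ s).1), h0]
  simp

lemma IsHypersurface.hasDerivAt_verticalPart (hε : ε = -1 ∨ ε = 1) (hS : IsHypersurface ε S N)
    {γ : ℝ → ℝ × ℝ} {v : ℝ × ℝ} {s : ℝ} (hmem : meridian ε o u (γ s) ∈ S)
    (hγ : HasDerivAt γ v s) :
    HasDerivAt (fun s => verticalPart ε o u N (γ s))
      (fderiv ℝ N (meridian ε o u (γ s)) (v.1 • radial ε o u (γ s).1, v.2)).2 s := by
  have hN := (hS.differentiableAt_normal hmem).hasFDerivAt.comp_hasDerivAt s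
    (hasDerivAt_meridian_comp (o := o) (u := u) hε hγ)
  exact hN.snd

lemma IsHypersurface.differentiableAt_parts (hS : IsHypersurface ε S N)
    {k : ℝ × ℝ} (hk : meridian ε o u k ∈ S) :
    DifferentiableAt ℝ (radialPart ε o u N) k ∧ DifferentiableAt ℝ (verticalPart ε o u N) k := by
  have hN : DifferentiableAt ℝ (fun k => N (meridian ε o u k)) k :=
    (hS.differentiableAt_normal hk).comp k
      ((contDiff_meridian (k := 1)).differentiable one_ne_zero k)
  have hr : DifferentiableAt ℝ (fun k : ℝ × ℝ => radial ε o u k.1) k := by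
    have h1 : ContDiff ℝ 1 fun p : ℝ × ℝ => cs ε p.1 := (contDiff_cs ε).comp contDiff_fst
    have h2 : ContDiff ℝ 1 fun p : ℝ × ℝ => sn ε p.1 := (contDiff_sn ε).comp contDiff_fst
    exact (((contDiff_const.mul h2).smul contDiff_const).add
      (h1.smul contDiff_const)).differentiable one_ne_zero k
  exact ⟨((hN.fst.fst.mul hr.fst).const_mul ε).add (hN.fst.snd.inner ℝ hr.snd), hN.snd⟩

end Curvature

/-! ### Classification of rotational spheres of constant mean curvature. -/

section Sphere

variable {m : ℕ} {ε H R : ℝ} {o : Vec (m + 1)} {f : Fin (m + 1) → Vec (m + 1)}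
  {S : Set (Amb (m + 1))} {N : Amb (m + 1) → Amb (m + 1)}

/-- The meridian section of a rotational hypersurface of constant mean curvature. -/
lemma IsHypersurface.isProfile (hε : ε = -1 ∨ ε = 1) (hS : IsHypersurface ε S N)
    (hH : HasConstMeanCurvature ε S N H) (ho : o ∈ spaceForm (m + 1) ε)
    (hrot : IsRotational ε o S) (hf : IsFrame ε o f) :
    IsProfile m ε H {k | meridian ε o (f 0) k ∈ S} (radialPart ε o (f 0) N)
      (verticalPart ε o (f 0) N) := by
  have hu : form ε (f 0) (f 0) = 1 := by simp [hf.orthonormal]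
  have hou := hf.orthogonal 0
  have horb : ∀ k, meridian ε o (f 0) k ∈ S → sn ε k.1 ≠ 0 → ∀ i : Fin m,
      form ε (N (meridian ε o (f 0) k)).1 (f i.succ) = 0 ∧
      sn ε k.1 * form ε (fderiv ℝ N (meridian ε o (f 0) k) (f i.succ, 0)).1 (f i.succ) =
        form ε (N (meridian ε o (f 0) k)).1 (f 0) := fun k hk hsn i =>
    hS.normal_orbit hε ho hrot hu hou (by simp [hf.orthonormal]) (hf.orthogonal _)
      (by simp [hf.orthonormal, (Fin.succ_ne_zero i).symm]) hk hsn
  have hrad : ∀ k, radialPart ε o (f 0) N k =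
      -ε * sn ε k.1 * form ε (N (meridian ε o (f 0) k)).1 o +
        cs ε k.1 * form ε (N (meridian ε o (f 0) k)).1 (f 0) := fun k => by
    simp only [radialPart, radial, form_add_right, form_smul_right]
  have htan : ∀ k, meridian ε o (f 0) k ∈ S →
      cs ε k.1 * form ε (N (meridian ε o (f 0) k)).1 o +
        sn ε k.1 * form ε (N (meridian ε o (f 0) k)).1 (f 0) = 0 := fun k hk => by
    have h1 : form ε (geodesic ε o (f 0) k.1) (N (meridian ε o (f 0) k)).1 = 0 :=
      hS.normal_tangent _ hk
    rwa [geodesic, form_add_left, form_smul_left, form_smul_left, form_comm o,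
      form_comm (f 0)] at h1
  have hunit : ∀ k, meridian ε o (f 0) k ∈ S → sn ε k.1 ≠ 0 →
      radialPart ε o (f 0) N k ^ 2 + verticalPart ε o (f 0) N k ^ 2 = 1 := fun k hk hsn => by
    have h1 := hS.normal_unit _ hk
    rw [metric, hf.form_self, Fin.sum_univ_succ, Finset.sum_eq_zero fun i _ => by
      rw [(horb k hk hsn i).1]; ring] at h1
    rw [← h1, hrad, verticalPart]
    have h2 := htan k hk
    have h3 := cs_sq_add hε k.1
    have h4 : ε * ε = 1 := by rcases hε with rfl | rfl <;> norm_num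
    set A := form ε (N (meridian ε o (f 0) k)).1 o
    set B := form ε (N (meridian ε o (f 0) k)).1 (f 0)
    set c := cs ε k.1
    set s := sn ε k.1
    linear_combination (ε * A ^ 2 + B ^ 2) * h3 - ε * (c * A + s * B) * h2
  refine ⟨fun k hk => (hS.differentiableAt_parts hk).1, fun k hk => (hS.differentiableAt_parts hk).2,
    hunit, fun k hk hsn => ?_, fun k hk hab => hS.exists_curve hε ho hu hou hk
      (by rw [hab]; exact one_ne_zero)⟩
  set a := radialPart ε o (f 0) N k with ha
  set b := verticalPart ε o (f 0) N k with hb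
  have hab : a ^ 2 + b ^ 2 = 1 := hunit k hk hsn
  have hdr : form ε (geodesic ε o (f 0) k.1) (radial ε o (f 0) k.1) = 0 :=
    form_geodesic_radial hε ho.1 hu hou _
  have hrr : form ε (radial ε o (f 0) k.1) (radial ε o (f 0) k.1) = 1 :=
    form_radial_self hε ho.1 hu hou _
  have hrf : ∀ i : Fin m, form ε (radial ε o (f 0) k.1) (f i.succ) = 0 := fun i => by
    simp only [radial, form_add_left, form_smul_left, hf.orthogonal, hf.orthonormal,
      if_neg (Fin.succ_ne_zero i).symm, mul_zero, add_zero]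
  -- One unit vector along the profile and m along the orbit: the trace splits into the curvature of
  -- the profile and m equal terms -(cs/sn) a.
  set e : Fin (m + 1) → Amb (m + 1) :=
    Fin.cons (b • radial ε o (f 0) k.1, -a) fun i => (f i.succ, 0) with he
  have he0 : e 0 = (b • radial ε o (f 0) k.1, -a) := rfl
  have hes : ∀ i : Fin m, e i.succ = (f i.succ, 0) := fun i => rfl
  have hframe : IsTangentFrame ε N (meridian ε o (f 0) k) e := by
    refine ⟨fun i => ?_, fun i => ?_, fun i j => ?_⟩
    · change form ε (geodesic ε o (f 0) k.1) (e i).1 = 0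
      refine Fin.cases ?_ (fun i => ?_) i
      · rw [he0, form_smul_right, hdr, mul_zero]
      · simp [hes, geodesic, form_add_left, form_smul_left, hf.orthogonal, hf.orthonormal,
          (Fin.succ_ne_zero i).symm]
    · refine Fin.cases ?_ (fun i => ?_) i
      · rw [he0]
        have := metric_meridian (ε := ε) (o := o) (u := f 0) (N := N) k (b, -a)
        rw [this]
        ring
      · rw [hes, metric, (horb k hk hsn i).1]
        simp
    · refine Fin.cases ?_ (fun i => ?_) i
      · refine Fin.cases ?_ (fun j => ?_) j
        · simp only [he0, metric, form_smul_left, form_smul_right, hrr, if_true]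
          linear_combination hab
        · simp [he0, hes, metric, form_smul_left, hrf, (Fin.succ_ne_zero j).symm]
      · refine Fin.cases ?_ (fun j => ?_) j
        · simp [he0, hes, metric, form_smul_left, form_comm (f i.succ), hrf, Fin.succ_ne_zero i]
        · simp [hes, metric, hf.orthonormal]
  have hcurv := hH _ hk e hframe
  rw [Fin.sum_univ_succ] at hcurv
  set D := fderiv ℝ N (meridian ε o (f 0) k) (b • radial ε o (f 0) k.1, -a) with hD
  have hγ : HasDerivAt (fun s : ℝ => k + s • (b, -a)) (b, -a) 0 := by
    simpa using ((hasDerivAt_id (0 : ℝ)).smul_const (b, -a)).const_add k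
  have hk0 : k + (0 : ℝ) • (b, -a) = k := by simp
  have hXa : fderiv ℝ (radialPart ε o (f 0) N) k (b, -a) =
      form ε D.1 (radial ε o (f 0) k.1) := by
    have h1 := hS.hasDerivAt_radialPart (o := o) (u := f 0) hε (by rwa [hk0]) hγ
    have h2 : DifferentiableAt ℝ (radialPart ε o (f 0) N) (k + (0 : ℝ) • (b, -a)) := by
      rw [hk0]; exact (hS.differentiableAt_parts hk).1
    have h3 := HasFDerivAt.comp_hasDerivAt (f := fun s : ℝ => k + s • (b, -a)) (0 : ℝ)
      h2.hasFDerivAt hγ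
    have h4 := h3.unique h1
    simpa only [hk0] using h4
  have hXb : fderiv ℝ (verticalPart ε o (f 0) N) k (b, -a) = D.2 := by
    have h1 := hS.hasDerivAt_verticalPart (o := o) (u := f 0) hε (by rwa [hk0]) hγ
    have h2 : DifferentiableAt ℝ (verticalPart ε o (f 0) N) (k + (0 : ℝ) • (b, -a)) := by
      rw [hk0]; exact (hS.differentiableAt_parts hk).2
    have h3 := HasFDerivAt.comp_hasDerivAt (f := fun s : ℝ => k + s • (b, -a)) (0 : ℝ)
      h2.hasFDerivAt hγ
    have h4 := h3.unique h1
    simpa only [hk0] using h4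
  have hneg : ∀ v w : Amb (m + 1), metric ε (-v) w = -metric ε v w := fun v w => by
    have := form_smul_left (ε := ε) (-1) v.1 w.1
    rw [neg_one_smul] at this
    simp only [metric, Prod.fst_neg, Prod.snd_neg, this]
    ring
  have hterm : ∀ i : Fin m, metric ε (-(fderiv ℝ N (meridian ε o (f 0) k) (e i.succ))) (e i.succ) =
      -(cs ε k.1 / sn ε k.1 * a) := fun i => by
    have h1 := (horb k hk hsn i).2
    have h2 : a * cs ε k.1 = form ε (N (meridian ε o (f 0) k)).1 (f 0) := by
      rw [ha, hrad]
      linear_combination (form ε (N (meridian ε o (f 0) k)).1 (f 0)) * cs_sq_add hε k.1 -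
        ε * sn ε k.1 * htan k hk
    rw [hneg, hes, metric]
    simp only [mul_zero, add_zero]
    rw [← h2] at h1
    field_simp
    linarith
  rw [Finset.sum_congr rfl fun i _ => hterm i, Finset.sum_const, Finset.card_univ,
    Fintype.card_fin, nsmul_eq_mul, he0, hneg, ← hD, metric, form_smul_right, ← hXa, ← hXb] at hcurv
  rw [← hcurv]
  ring

lemma radius_geodesic (hε : ε = -1 ∨ ε = 1) (ho : form ε o o = ε) {u : Vec (m + 1)}
    (hou : form ε o u = 0) {r : ℝ} (hr : 0 ≤ r) (hr' : ε = 1 → r ≤ Real.pi) :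
    radius ε o (geodesic ε o u r) = r := by
  refine radius_eq hε hr hr' ?_
  rw [form_geodesic ho hou, ← mul_assoc]
  rcases hε with rfl | rfl <;> norm_num

lemma Admissible.R_lt_pi (h : Admissible m 1 R) : R < Real.pi := by
  by_contra! hle
  have := h.cs_pos (Real.pi / 2) ⟨by positivity, by linarith [Real.pi_pos]⟩
  simp [cs] at this

/-- A point whose distance from `o` is zero is `o`. -/
lemma eq_of_radius_eq_zero (hε : ε = -1 ∨ ε = 1) (ho : o ∈ spaceForm (m + 1) ε)
    {x : Vec (m + 1)} (hx : x ∈ spaceForm (m + 1) ε) (h : radius ε o x = 0) : x = o := by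
  obtain ⟨f, hf⟩ := exists_isFrame hε ho.1
  have h1 := cs_radius hε ho hx
  rw [h, cs_zero] at h1
  have h2 : form ε o x = ε := by
    rcases hε with rfl | rfl <;> linarith
  refine sub_eq_zero.1 (hf.eq_zero ?_ ?_)
  · rw [form_sub_left, form_comm x o, h2, ho.1, sub_self]
  · simp only [form_sub_left, form_sub_right, form_comm x o, h2, ho.1, hx.1]
    ring

/-- At the lowest point of a rotational hypersurface the normal is vertical. -/
lemma IsHypersurface.normal_lowest (hε : ε = -1 ∨ ε = 1) (hS : IsHypersurface ε S N)
    (ho : o ∈ spaceForm (m + 1) ε) {h : ℝ} (hmem : (o, h) ∈ S) (hlow : ∀ p ∈ S, h ≤ p.2) :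
    (N (o, h)).1 = 0 ∧ (N (o, h)).2 ^ 2 = 1 := by
  obtain ⟨f, hf⟩ := exists_isFrame hε ho.1
  have hmer : ∀ u : Vec (m + 1), meridian ε o u (0, h) = (o, h) := fun u => by
    simp [meridian, geodesic]
  have hzero : ∀ i, form ε (N (o, h)).1 (f i) = 0 := by
    intro i
    have ha : radialPart ε o (f i) N (0, h) = form ε (N (o, h)).1 (f i) := by
      simp [radialPart, hmer, radial]
    by_contra hne
    -- With a nonzero horizontal component, the section in direction f i is a regular curve. Minimal
    -- height kills the vertical part of its velocity and tangency kills the radial part,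
    -- contradicting v ≠ 0.
    obtain ⟨δ, hδ, γ, v, hγ0, hγ, -⟩ := hS.exists_curve hε ho
      (by simp [hf.orthonormal]) (hf.orthogonal i) (k := (0, h)) (by rwa [hmer])
      (by rw [ha]; positivity)
    have h0δ : (0 : ℝ) ∈ Ioo (-δ) δ := ⟨by linarith, hδ⟩
    obtain ⟨-, hd, hv, htan⟩ := hγ 0 h0δ
    have hd2 : HasDerivAt (fun s => (γ s).2) (v 0).2 0 := hd.snd
    have hmin : IsLocalMin (fun s => (γ s).2) 0 := by
      filter_upwards [isOpen_Ioo.mem_nhds h0δ] with s hs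
      rw [hγ0]
      exact hlow _ (hγ s hs).1
    have hv2 := hmin.hasDerivAt_eq_zero hd2
    rw [hγ0, hv2, mul_zero, add_zero, ha, mul_eq_zero, or_iff_right hne] at htan
    exact hv (Prod.ext htan hv2)
  have hzo : form ε (N (o, h)).1 o = 0 := (form_comm _ _).trans (hS.normal_tangent _ hmem)
  have hz : (N (o, h)).1 = 0 := by
    rw [hf.expand (N (o, h)).1, hzo]
    simp [hzero]
  refine ⟨hz, ?_⟩
  have := hS.normal_unit _ hmem
  rw [metric, hz, form_zero_left] at this
  linarith

/-- Classification: a rotational sphere of constant mean curvature is the rotation of the profile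
curve. -/
theorem IsRotationalCMCSphere.mem_iff (hA : AdmissibleCurv m ε R H)
    (ho : o ∈ spaceForm (m + 1) ε) {h : ℝ} (hS : IsRotationalCMCSphere ε o h H S)
    (p : Amb (m + 1)) : p ∈ S ↔ p.1 ∈ spaceForm (m + 1) ε ∧
      (radius ε o p.1, p.2) ∈ profileCurve m ε R H h := by
  have hε := hA.eps
  obtain ⟨f, hf⟩ := exists_isFrame hε ho.1
  obtain ⟨N, hN, hH⟩ := hS.cmc
  obtain ⟨Θ⟩ := hS.sphere
  have hu : form ε (f 0) (f 0) = 1 := by simp [hf.orthonormal]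
  have hou := hf.orthogonal 0
  have hprof := hN.isProfile hε hH ho hS.rotational hf
  have hrank : 1 < Module.rank ℝ (EuclideanSpace ℝ (Fin (m + 1 + 1))) := by
    rw [← Module.finrank_eq_rank, finrank_euclideanSpace_fin]
    have := hA.one_le
    exact_mod_cast (by omega : 1 < m + 1 + 1)
  -- The homeomorphism with the round sphere enters only through compactness, connectedness and the
  -- existence of two points.
  have hScomp : IsCompact S := by
    have : CompactSpace S := Θ.symm.compactSpace
    exact isCompact_iff_compactSpace.2 this
  have hSconn : IsPreconnected S := by
    have h1 : PreconnectedSpace (Metric.sphere (0 : EuclideanSpace ℝ (Fin (m + 1 + 1))) 1) :=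
      Subtype.preconnectedSpace (isPreconnected_sphere hrank 0 1)
    have h2 := isPreconnected_range (continuous_subtype_val.comp Θ.symm.continuous)
    rwa [Θ.symm.surjective.range_comp, Subtype.range_coe] at h2
  have hSnt : S.Nontrivial := by
    rw [← Set.nontrivial_coe_sort]
    have hne : (Metric.sphere (0 : EuclideanSpace ℝ (Fin (m + 1 + 1))) 1).Nontrivial := by
      have hsingle : EuclideanSpace.single (0 : Fin (m + 1 + 1)) (1 : ℝ) ∈
          Metric.sphere (0 : EuclideanSpace ℝ (Fin (m + 1 + 1))) 1 := by simp
      refine ⟨_, hsingle, -EuclideanSpace.single 0 1, by simp, fun heq => ?_⟩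
      have := congrArg (fun x : EuclideanSpace ℝ (Fin (m + 1 + 1)) => x 0) heq
      simp at this
      norm_num at this
    have := hne.coe_sort
    exact Θ.toEquiv.nontrivial
  set π : Amb (m + 1) → ℝ × ℝ := fun p => (radius ε o p.1, p.2) with hπ
  have hπc : ContinuousOn π S := by
    refine ContinuousOn.prodMk ?_ continuous_snd.continuousOn
    exact (continuousOn_radius hε ho).comp continuous_fst.continuousOn
      fun p hp => (hN.subset hp).1
  -- By rotational invariance membership depends only on radius and height, so it can be tested in a
  -- single meridian.
  have hswap : ∀ p : Amb (m + 1), p.1 ∈ spaceForm (m + 1) ε →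
      (p ∈ S ↔ meridian ε o (f 0) (π p) ∈ S) := fun p hp => by
    refine hS.rotational.mem_iff hε ho.1 hp.1 (form_geodesic_self hε ho.1 hu hou _) ?_
    rw [form_geodesic ho.1 hou]
    simp only [hπ]
    rw [cs_radius hε ho hp]
    rcases hε with rfl | rfl <;> ring
  have hradgeo : ∀ r, 0 ≤ r → r ≤ R → radius ε o (geodesic ε o (f 0) r) = r := by
    intro r h0 h1
    refine radius_geodesic hε ho.1 hou h0 ?_
    rintro rfl
    exact h1.trans hA.R_lt_pi.le
  have hmero : meridian ε o (f 0) (0, h) = (o, h) := by simp [meridian, geodesic]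
  have hπo : π (o, h) = (0, h) := by
    have h1 := hradgeo 0 le_rfl hA.pos.le
    have h2 : geodesic ε o (f 0) 0 = o := by simp [geodesic]
    rw [h2] at h1
    simp [hπ, h1]
  obtain ⟨hN1, hN2⟩ := hN.normal_lowest hε ho hS.lowest_mem hS.lowest
  have hK := hprof.eq_profileCurve hA (K := π '' S) (d := h)
    (by
      rintro _ ⟨p, hp, rfl⟩
      exact (hswap p (hN.subset hp).1).1 hp)
    (by
      rintro _ ⟨p, hp, rfl⟩
      exact radius_nonneg hε ho (hN.subset hp).1)
    (fun k hk h0 h1 => ⟨_, hk, Prod.ext (hradgeo k.1 h0 h1) rfl⟩)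
    (hScomp.image_of_continuousOn hπc) (hSconn.image π hπc)
    (by
      by_contra hsub
      rw [Set.not_nontrivial_iff] at hsub
      obtain ⟨p, hp, q, hq, hpq⟩ := hSnt
      have hall : ∀ p ∈ S, p = (o, h) := fun p hp => by
        have h1 := hsub ⟨p, hp, rfl⟩ ⟨(o, h), hS.lowest_mem, rfl⟩
        rw [hπo] at h1
        exact Prod.ext (eq_of_radius_eq_zero hε ho (hN.subset hp).1 (congrArg Prod.fst h1))
          (show p.2 = h from congrArg Prod.snd h1)
      exact hpq ((hall p hp).trans (hall q hq).symm))
    ⟨(o, h), hS.lowest_mem, hπo⟩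
    (by
      rintro _ ⟨p, hp, rfl⟩
      exact hS.lowest p hp)
    (by rw [radialPart, hmero, hN1, form_zero_left])
    (by rw [verticalPart, hmero, hN2])
  constructor
  · intro hp
    exact ⟨(hN.subset hp).1, hK ▸ ⟨p, hp, rfl⟩⟩
  · rintro ⟨hp, hk⟩
    have hk' : π p ∈ π '' S := hK ▸ hk
    obtain ⟨q, hq, hqp⟩ := hk'
    rw [hswap p hp, ← hqp, ← hswap q (hN.subset hq).1]
    exact hq

end Sphere

end QProd

/-! ### The solid region in the half-plane. -/

namespace QProd

open Set Filter Topology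

section Solid

variable {m : ℕ} {ε R H d : ℝ}

/-- The region of the half-plane bounded by the axis and `profileCurve`. -/
def solid (m : ℕ) (ε R H d : ℝ) : Set (ℝ × ℝ) :=
  {k | k.1 ∈ Icc 0 R ∧ H * ratio m ε k.1 ≤ 1 ∧
    height m ε R H (Real.arcsin (H * ratio m ε k.1)) + d ≤ k.2 ∧
    k.2 ≤ height m ε R H (Real.pi - Real.arcsin (H * ratio m ε k.1)) + d}

lemma AdmissibleCurv.profileCurve_subset_solid (h : AdmissibleCurv m ε R H) :
    profileCurve m ε R H d ⊆ solid m ε R H d := by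
  rintro k ⟨hr, θ, hθ, hs, ht⟩
  refine ⟨hr, hs.trans_le (Real.sin_le_one θ), ?_⟩
  rw [hs, ht]
  have hmono := h.strictMonoOn_height.monotoneOn
  have hθ' : Real.pi - θ ∈ Icc 0 Real.pi := ⟨by linarith [hθ.2], by linarith [hθ.1]⟩
  rcases le_total θ (Real.pi / 2) with hle | hle
  · rw [Real.arcsin_sin (by linarith [hθ.1, Real.pi_pos]) hle]
    exact ⟨le_rfl, add_le_add_left (hmono hθ hθ' (by linarith)) d⟩
  · rw [← Real.sin_pi_sub, Real.arcsin_sin (by linarith [hθ.2, Real.pi_pos]) (by linarith),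
      sub_sub_cancel]
    exact ⟨add_le_add_left (hmono hθ' hθ (by linarith)) d, le_rfl⟩

/-- For larger H the lower boundary rises. The upper boundary is total height minus lower height,
where the first term falls and the second grows, so it descends. -/
lemma AdmissibleCurv.solid_subset {H' : ℝ} (h : AdmissibleCurv m ε R H) (hH : H ≤ H') :
    solid m ε R H' d ⊆ solid m ε R H d := by
  rintro k ⟨hr, h1, h2, h3⟩
  have h' := h.mono hH
  have hg := h.ratio_nonneg hr
  have hle : H * ratio m ε k.1 ≤ H' * ratio m ε k.1 := mul_le_mul_of_nonneg_right hH hg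
  have h4 := h.height_arcsin_le hH hg h1
  have h5 := h.height_pi_le hH
  have h6 := h.height_pi_sub (arcsin_mem_Icc_zero_pi (mul_nonneg h.H_pos.le hg))
  have h7 := h'.height_pi_sub (arcsin_mem_Icc_zero_pi (mul_nonneg h'.H_pos.le hg))
  refine ⟨hr, hle.trans h1, by linarith, ?_⟩
  rw [h6]
  rw [h7] at h3
  linarith

lemma AdmissibleCurv.strict_of_mem_solid (h : AdmissibleCurv m ε R H) {k : ℝ × ℝ}
    (hk : k ∈ solid m ε R H d) (hk' : k ∉ profileCurve m ε R H d) :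
    k.1 < R ∧ H * ratio m ε k.1 < 1 ∧
    height m ε R H (Real.arcsin (H * ratio m ε k.1)) + d < k.2 ∧
    k.2 < height m ε R H (Real.pi - Real.arcsin (H * ratio m ε k.1)) + d := by
  obtain ⟨hr, h1, h2, h3⟩ := hk
  have h0 : 0 ≤ H * ratio m ε k.1 := mul_nonneg h.H_pos.le (h.ratio_nonneg hr)
  have hmem := arcsin_mem_Icc_zero_pi h0
  have hsin := Real.sin_arcsin (by linarith) h1
  have hlow : height m ε R H (Real.arcsin (H * ratio m ε k.1)) + d ≠ k.2 := fun he =>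
    hk' ⟨hr, _, hmem, hsin.symm, he.symm⟩
  have hup : k.2 ≠ height m ε R H (Real.pi - Real.arcsin (H * ratio m ε k.1)) + d := fun he =>
    hk' ⟨hr, _, ⟨by linarith [hmem.2], by linarith [hmem.1]⟩, by
      rw [Real.sin_pi_sub, hsin], he⟩
  refine ⟨?_, lt_of_le_of_ne h1 fun he => ?_, lt_of_le_of_ne h2 hlow, lt_of_le_of_ne h3 hup⟩
  · rw [← h.strictMonoOn_ratio.lt_iff_lt hr h.R_mem]
    refine lt_of_le_of_lt ?_ h.lt_ratio
    rwa [le_div_iff₀ h.H_pos, mul_comm]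
  · rw [he, Real.arcsin_one] at h2 h3 hlow
    rw [show Real.pi - Real.pi / 2 = Real.pi / 2 by ring] at h3
    exact hlow (le_antisymm h2 h3)

/-- A connected set that avoids the profile curve and meets the solid region lies inside it. -/
lemma AdmissibleCurv.subset_solid (h : AdmissibleCurv m ε R H) {T : Set (ℝ × ℝ)}
    (hT : IsPreconnected T) (hT0 : ∀ k ∈ T, 0 ≤ k.1)
    (hTp : ∀ k ∈ T, k ∉ profileCurve m ε R H d) {k₀ : ℝ × ℝ} (hk₀ : k₀ ∈ T)
    (hk₀' : k₀ ∈ solid m ε R H d) : T ⊆ solid m ε R H d := by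
  -- Clamping the radius makes the bounding functions continuous on the whole plane, so that u is
  -- open and w is closed. Off the profile curve T cannot meet w outside u, and hence u and the
  -- complement of w separate T.
  set clamp : ℝ → ℝ := fun r => max 0 (min r R) with hclamp
  have hcl : ∀ r, 0 ≤ r → r ≤ R → clamp r = r := fun r h0 h1 => by
    simp only [hclamp, min_eq_left h1, max_eq_right h0]
  have hclmem : ∀ r, clamp r ∈ Icc 0 R := fun r =>
    ⟨le_max_left _ _, max_le h.pos.le (min_le_right _ _)⟩
  set g : ℝ × ℝ → ℝ := fun k => H * ratio m ε (clamp k.1) with hg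
  have hgc : Continuous g := by
    refine continuous_const.mul (h.continuousOn_ratio.comp_continuous ?_ fun k => hclmem k.1)
    fun_prop
  have hg0 : ∀ k, 0 ≤ g k := fun k => mul_nonneg h.H_pos.le (h.ratio_nonneg (hclmem k.1))
  have hac : Continuous fun k => Real.arcsin (g k) := Real.continuous_arcsin.comp hgc
  have hA : Continuous fun k => height m ε R H (Real.arcsin (g k)) + d :=
    (h.continuousOn_height.comp_continuous hac
      fun k => arcsin_mem_Icc_zero_pi (hg0 k)).add continuous_const
  have hB : Continuous fun k => height m ε R H (Real.pi - Real.arcsin (g k)) + d :=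
    (h.continuousOn_height.comp_continuous (continuous_const.sub hac) fun k => by
      have := arcsin_mem_Icc_zero_pi (hg0 k)
      exact ⟨sub_nonneg.2 this.2, sub_le_self _ this.1⟩).add continuous_const
  set u : Set (ℝ × ℝ) := {k | k.1 < R ∧ g k < 1 ∧
    height m ε R H (Real.arcsin (g k)) + d < k.2 ∧
    k.2 < height m ε R H (Real.pi - Real.arcsin (g k)) + d} with hu
  set w : Set (ℝ × ℝ) := {k | k.1 ≤ R ∧ g k ≤ 1 ∧
    height m ε R H (Real.arcsin (g k)) + d ≤ k.2 ∧
    k.2 ≤ height m ε R H (Real.pi - Real.arcsin (g k)) + d} with hw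
  have huo : IsOpen u :=
    (isOpen_lt continuous_fst continuous_const).inter ((isOpen_lt hgc continuous_const).inter
      ((isOpen_lt hA continuous_snd).inter (isOpen_lt continuous_snd hB)))
  have hwc : IsClosed w :=
    (isClosed_le continuous_fst continuous_const).inter ((isClosed_le hgc continuous_const).inter
      ((isClosed_le hA continuous_snd).inter (isClosed_le continuous_snd hB)))
  have huw : u ⊆ w := fun k hk => ⟨hk.1.le, hk.2.1.le, hk.2.2.1.le, hk.2.2.2.le⟩
  have hws : ∀ k, 0 ≤ k.1 → k ∈ w → k ∈ solid m ε R H d := by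
    rintro k h0 ⟨h1, h2, h3, h4⟩
    simp only [hg, hcl k.1 h0 h1] at h2 h3 h4
    exact ⟨⟨h0, h1⟩, h2, h3, h4⟩
  have hsu : ∀ k ∈ T, k ∈ solid m ε R H d → k ∈ u := by
    intro k hk hks
    have h1 := h.strict_of_mem_solid hks (hTp k hk)
    change k.1 < R ∧ g k < 1 ∧ _ ∧ _
    simpa only [hg, hcl k.1 (hT0 k hk) hks.1.2] using h1
  have hTu : T ⊆ u := hT.subset_left_of_subset_union huo hwc.isOpen_compl
    (disjoint_compl_right_iff_subset.2 huw)
    (fun k hk => by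
      by_cases hkw : k ∈ w
      · exact Or.inl (hsu k hk (hws k (hT0 k hk) hkw))
      · exact Or.inr hkw)
    ⟨k₀, hk₀, hsu k₀ hk₀ hk₀'⟩
  exact fun k hk => hws k (hT0 k hk) (huw (hTu hk))

end Solid

/-! ### The region determined by a sphere is the rotated solid. -/

section Region

variable {m : ℕ} {ε R H h : ℝ} {o : Vec (m + 1)} {S : Set (Amb (m + 1))}

/-- A subset of the product over which the distance from the axis and the height are bounded is
bounded. -/
lemma isBounded_of_radius (hε : ε = -1 ∨ ε = 1) (ho : o ∈ spaceForm (m + 1) ε) {a b : ℝ}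
    {T : Set (Amb (m + 1))}
    (hT : ∀ p ∈ T, p.1 ∈ spaceForm (m + 1) ε ∧ radius ε o p.1 ∈ Icc 0 R ∧ p.2 ∈ Icc a b) :
    Bornology.IsBounded T := by
  obtain ⟨f, hf⟩ := exists_isFrame hε ho.1
  obtain ⟨M, hM⟩ := isCompact_Icc.exists_bound_of_continuousOn
    (continuous_cs ε).continuousOn (s := Icc 0 R)
  rw [isBounded_iff_forall_norm_le]
  refine ⟨max (M * ‖o‖ + ∑ i, (1 + M ^ 2) * ‖f i‖) (max |a| |b|), fun p hp => ?_⟩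
  obtain ⟨hp1, hp2, hp3⟩ := hT p hp
  refine max_le_max ?_ (abs_le_max_abs_abs hp3.1 hp3.2)
  have hc : |ε * form ε p.1 o| ≤ M := by
    rw [form_comm, ← cs_radius hε ho hp1]
    exact hM _ hp2
  have hM0 : 0 ≤ M := (abs_nonneg _).trans hc
  have hε2 : ε * ε = 1 := by rcases hε with rfl | rfl <;> norm_num
  have hsum : ∑ i, form ε p.1 (f i) ^ 2 ≤ 1 + M ^ 2 := by
    have h1 := hf.form_self p.1
    rw [hp1.1] at h1
    have h2 : (ε * form ε p.1 o) ^ 2 ≤ M ^ 2 := sq_le_sq' (abs_le.1 hc).1 (abs_le.1 hc).2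
    have h3 : (ε * form ε p.1 o) ^ 2 = form ε p.1 o ^ 2 := by
      rw [mul_pow, sq ε, hε2, one_mul]
    rw [h3] at h2
    have h4 := sq_nonneg (form ε p.1 o)
    rcases hε with rfl | rfl <;> linarith
  have hi : ∀ i, |form ε p.1 (f i)| ≤ 1 + M ^ 2 := fun i => by
    have h1 := Finset.single_le_sum (f := fun i => form ε p.1 (f i) ^ 2)
      (fun i _ => sq_nonneg _) (Finset.mem_univ i)
    refine abs_le_of_sq_le_sq ?_ (by positivity)
    nlinarith [sq_nonneg M]
  conv_lhs => rw [hf.expand p.1]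
  refine (norm_add_le _ _).trans (add_le_add ?_ ((norm_sum_le _ _).trans
    (Finset.sum_le_sum fun i _ => ?_)))
  · rw [norm_smul]
    exact mul_le_mul_of_nonneg_right hc (norm_nonneg _)
  · rw [norm_smul]
    exact mul_le_mul_of_nonneg_right (hi i) (norm_nonneg _)

/-- The region determined by a rotational sphere is contained in the rotation of the solid
region. -/
lemma IsRotationalCMCSphere.region_subset (hA : AdmissibleCurv m ε R H)
    (ho : o ∈ spaceForm (m + 1) ε) (hS : IsRotationalCMCSphere ε o h H S) {p : Amb (m + 1)}
    (hp : p ∈ region ε S) :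
    p.1 ∈ spaceForm (m + 1) ε ∧ (radius ε o p.1, p.2) ∈ solid m ε R H h := by
  have hmem := hS.mem_iff hA ho
  rcases hp with hp | ⟨hp, hb⟩
  · exact ⟨((hmem p).1 hp).1, hA.profileCurve_subset_solid ((hmem p).1 hp).2⟩
  refine ⟨hp.1.1, ?_⟩
  by_contra hout
  -- A vertical segment or ray through p that misses the solid stays in the component of p, so it
  -- must be bounded.
  have hray : ∀ I : Set ℝ, IsPreconnected I → p.2 ∈ I →
      (∀ t ∈ I, (radius ε o p.1, t) ∉ solid m ε R H h) → Bornology.IsBounded I := by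
    intro I hI hpI hIs
    have hsub : (fun t => (p.1, t)) '' I ⊆ connectedComponentIn (space (m + 1) ε \ S) p := by
      refine (hI.image _ (by fun_prop)).subset_connectedComponentIn ⟨p.2, hpI, rfl⟩ ?_
      rintro _ ⟨t, ht, rfl⟩
      exact ⟨⟨hp.1.1, mem_univ _⟩, fun hmS =>
        hIs t ht (hA.profileCurve_subset_solid ((hmem _).1 hmS).2)⟩
    obtain ⟨C, hC⟩ := isBounded_iff_forall_norm_le.1 (hb.subset hsub)
    exact isBounded_iff_forall_norm_le.2
      ⟨C, fun t ht => (norm_snd_le (p.1, t)).trans (hC _ ⟨t, ht, rfl⟩)⟩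
  -- The solid meets each vertical line in an interval, so a point outside can escape to infinity
  -- upwards or downwards.
  have hcases : (∀ t ∈ Ici p.2, (radius ε o p.1, t) ∉ solid m ε R H h) ∨
      (∀ t ∈ Iic p.2, (radius ε o p.1, t) ∉ solid m ε R H h) := by
    by_contra! hcon
    obtain ⟨⟨t₁, ht₁, h1⟩, ⟨t₂, ht₂, h2⟩⟩ := hcon
    exact hout ⟨h1.1, h1.2.1, h2.2.2.1.trans ht₂, (show p.2 ≤ t₁ from ht₁).trans h1.2.2.2⟩
  rcases hcases with hI | hI
  · exact not_bddAbove_Ici (a := p.2) (hray _ isPreconnected_Ici self_mem_Ici hI).bddAbove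
  · exact not_bddBelow_Iic (a := p.2) (hray _ isPreconnected_Iic self_mem_Iic hI).bddBelow

/-- The rotation of the solid region is contained in the region determined by a rotational
sphere. -/
lemma IsRotationalCMCSphere.subset_region (hA : AdmissibleCurv m ε R H)
    (ho : o ∈ spaceForm (m + 1) ε) (hS : IsRotationalCMCSphere ε o h H S) {p : Amb (m + 1)}
    (hp : p.1 ∈ spaceForm (m + 1) ε) (hps : (radius ε o p.1, p.2) ∈ solid m ε R H h) :
    p ∈ region ε S := by
  have hε := hA.eps
  have hmem := hS.mem_iff hA ho
  by_cases hpS : p ∈ S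
  · exact Or.inl hpS
  have hpc : p ∈ space (m + 1) ε \ S := ⟨⟨hp, mem_univ _⟩, hpS⟩
  refine Or.inr ⟨hpc, ?_⟩
  set C := connectedComponentIn (space (m + 1) ε \ S) p
  have hCs : C ⊆ space (m + 1) ε \ S := connectedComponentIn_subset _ _
  have hπc : ContinuousOn (fun q : Amb (m + 1) => (radius ε o q.1, q.2)) C :=
    ((continuousOn_radius hε ho).comp continuous_fst.continuousOn
      fun q hq => (hCs hq).1.1).prodMk continuous_snd.continuousOn
  -- The component projects to a connected set avoiding the profile curve; starting in the solid it
  -- remains there, so it is bounded.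
  have hsub := hA.subset_solid (isPreconnected_connectedComponentIn.image _ hπc) (d := h)
    (by
      rintro _ ⟨q, hq, rfl⟩
      exact radius_nonneg hε ho (hCs hq).1.1)
    (by
      rintro _ ⟨q, hq, rfl⟩ hprof
      exact (hCs hq).2 ((hmem q).2 ⟨(hCs hq).1.1, hprof⟩))
    ⟨p, mem_connectedComponentIn hpc, rfl⟩ hps
  refine isBounded_of_radius hε ho (R := R) (a := h) (b := height m ε R H Real.pi + h)
    fun q hq => ?_
  obtain ⟨h1, -, h3, h4⟩ := hsub ⟨q, hq, rfl⟩
  have h0 : 0 ≤ H * ratio m ε (radius ε o q.1) := mul_nonneg hA.H_pos.le (hA.ratio_nonneg h1)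
  have hθ := arcsin_mem_Icc_zero_pi h0
  have hmono := hA.strictMonoOn_height.monotoneOn
  have h5 := hmono ⟨le_rfl, Real.pi_pos.le⟩ hθ hθ.1
  have h6 := hmono (a := Real.pi - Real.arcsin (H * ratio m ε (radius ε o q.1)))
    ⟨by linarith [hθ.2], by linarith [hθ.1]⟩ ⟨Real.pi_pos.le, le_rfl⟩ (by linarith [hθ.1])
  rw [height_zero] at h5
  exact ⟨(hCs hq).1.1, h1, by linarith, by linarith⟩

/-- Rotational spheres with the same lowest point are nested, as long as they lie in a ball of the
space form where `ratio` is log-concave. -/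
theorem IsRotationalCMCSphere.region_mono {H' : ℝ} {S' : Set (Amb (m + 1))}
    (hA : AdmissibleCurv m ε R H) (hH : H ≤ H') (ho : o ∈ spaceForm (m + 1) ε)
    (hS' : IsRotationalCMCSphere ε o h H' S') (hS : IsRotationalCMCSphere ε o h H S) :
    region ε S' ⊆ region ε S := fun _ hp =>
  have h1 := hS'.region_subset (hA.mono hH) ho hp
  hS.subset_region hA ho h1.1 (hA.solid_subset hH h1.2)

end Region

end QProd

/-! ### The choice of α. -/

theorem theorem1 (n : ℕ) (hn : 2 ≤ n) (ε : ℝ) (hε : ε = -1 ∨ ε = 1) :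
    ∃ α : ℝ, 0 ≤ α ∧ QProd.critCurv n ε ≤ α ∧ (ε = -1 → α = QProd.critCurv n ε) ∧
      ∀ o ∈ QProd.spaceForm n ε, ∀ (h H Hstar : ℝ) (S Sstar : Set (QProd.Amb n)),
        QProd.IsRotationalCMCSphere ε o h H S →
        QProd.IsRotationalCMCSphere ε o h Hstar Sstar →
        α < Hstar → Hstar < H →
        QProd.region ε S ⊆ QProd.region ε Sstar := by
  obtain ⟨m, rfl⟩ : ∃ m, n = m + 1 := ⟨n - 1, by omega⟩
  have hm : 1 ≤ m := by omega
  rcases hε with rfl | rfl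
  · have hcrit : QProd.critCurv (m + 1) (-1) = m := by simp [QProd.critCurv]
    refine ⟨m, by positivity, hcrit.le, fun _ => hcrit.symm, ?_⟩
    intro o ho h H Hstar S Sstar hS hSstar hα hH
    -- In the hyperbolic case the radius may depend on the smaller curvature, since log-concavity
    -- holds on every ball; so α needs no room above the critical value.
    obtain ⟨R, hR, hlt⟩ := QProd.exists_lt_ratio_neg_one hm hα
    have hA : QProd.AdmissibleCurv m (-1) R Hstar :=
      ⟨QProd.admissible_neg_one hm hR, lt_of_le_of_lt (by positivity) hα, hlt⟩
    exact hS.region_mono hA hH.le ho hSstar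
  · have hadm := QProd.admissible_one hm
    have hpos := hadm.ratio_pos ⟨hadm.pos, le_rfl⟩
    have hne : ¬ ((1 : ℝ) = -1) := by norm_num
    have hcrit : QProd.critCurv (m + 1) 1 = 0 := by simp [QProd.critCurv, hne]
    -- Curvature above this value means 1/H < ratio(π/4), so the sphere stays where log-concavity is
    -- known.
    refine ⟨1 / QProd.ratio m 1 (Real.pi / 4), by positivity, hcrit.trans_le (by positivity),
      fun h => absurd h hne, ?_⟩
    intro o ho h H Hstar S Sstar hS hSstar hα hH
    have hHpos : 0 < Hstar := lt_of_le_of_lt (by positivity) hα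
    have hA : QProd.AdmissibleCurv m 1 (Real.pi / 4) Hstar :=
      ⟨hadm, hHpos, (one_div_lt hpos hHpos).1 hα⟩
    exact hS.region_mono hA hH.le ho hSstar
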